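/- Let $d\ge 1$, let $V:\mathbb Z^d\to\mathbb R$ be arbitrary, and let $H=\Delta+V$ be the self-adjoint operator $(H\psi)(n)=\sum_{|n-m|=1}\psi(m)+V(n)\psi(n)$ on $\ell^2(\mathbb Z^d)$, with domain $\{\psi\in\ell^2 : H\psi\in\ell^2\}$, where $|n|=\sum_i|n_i|$. Let $\mu_{\delta_0}$ be the spectral measure of $\delta_0$ and $H$, that is, the finite Borel measure on $\mathbb R$ with $\langle (H-z)^{-1}\delta_0,\delta_0\rangle=\int\frac{d\mu_{\delta_0}(x)}{x-z}$ for all non-real $z$. Let $\rho_0,\rho_1,\dots$ be the orthonormal vectors obtained from $\delta_0,H\delta_0,H^2\delta_0,\dots$ by the Gram–Schmidt procedure, and consider the tridiagonal representation of $H$ in them, in which $\rho_n$ is identified with $\delta_{n+1}$: $a(n)=\langle\rho_n,H\rho_{n-1}\rangle$ and $b(n)=\langle\rho_{n-1},H\rho_{n-1}\rangle$ for $n\ge 1$, and $a(0)=1$. For $E,\theta\in\mathbb R$ let $u_\theta(n,E)$, $n\ge0$, be the solution of $a(n)u(n+1)+a(n-1)u(n-1)+b(n)u(n)=Eu(n)$,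 $n\ge 1$, with $u_\theta(0,E)=\sin\theta$, $u_\theta(1,E)=\cos\theta$. For $\ell\ge0$ put $\|u\|_\ell^2=\sum_{n=1}^{\lfloor \ell\rfloor}|u(n)|^2+(\ell-\lfloor \ell\rfloor)|u(\lfloor \ell\rfloor+1)|^2$. For $\epsilon>0$ let $L^+_\epsilon(E)$ be the number $\ell$ with $\max_\theta\|u_\theta(\cdot,E)\|_\ell\cdot\min_\theta\|u_\theta(\cdot,E)\|_\ell=\epsilon^{-1}$ (and $L^+_\epsilon(E)=\infty$ if there is no such $\ell$). For $R>0$ let $\chi_R$ be the orthogonal projection of $\ell^2(\mathbb Z^d)$ on the functions supported in the ball $\{n : |n|<R\}$. For a function $A$ of time write $\langle A\rangle_T=\frac2T\int_0^\infty e^{-2t/T}A(t)\,dt$. Then there is a universal constant $C>0$ (independent of $d$, $V$, $T$, $L$) such that for all $d\ge 1$, all $V$, all $T>0$ and all $L>1$, $$\big\langle\|\chi_{L+1}e^{-iHt}\delta_0\|^2\big\rangle_T> C\,\mu_{\delta_0}\big(\{E : L^+_{T^{-1}}(E)\le L\}\big).$$ -/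

import Mathlib

open MeasureTheory Filter Topology

noncomputable section

namespace Lattice

/-- The Hilbert space `ℓ²(ℤ^d)`. -/
abbrev L2 (d : ℕ) : Type := lp (fun _ : Fin d → ℤ => ℂ) 2

/-- The length `|n| = ∑ |n_i|` of a lattice site. -/
def siteNorm {d : ℕ} (n : Fin d → ℤ) : ℤ := ∑ i, |n i|

/-- The sites `m` with `|n - m| = 1`. -/
def neighbors {d : ℕ} (n : Fin d → ℤ) : Finset (Fin d → ℤ) :=
  {m ∈ Finset.Icc (fun i => n i - 1) (fun i => n i + 1) | siteNorm (n - m) = 1}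

/-- The sites `n` with `|n| < R`. -/
def ball (d : ℕ) (R : ℝ) : Finset (Fin d → ℤ) :=
  {n ∈ Finset.Icc (fun _ => -⌈R⌉) (fun _ => ⌈R⌉) | (siteNorm n : ℝ) < R}

theorem abs_le_siteNorm {d : ℕ} (n : Fin d → ℤ) (i : Fin d) : |n i| ≤ siteNorm n :=
  Finset.single_le_sum (f := fun i => |n i|) (fun _ _ => abs_nonneg _) (Finset.mem_univ i)

theorem mem_neighbors {d : ℕ} {n m : Fin d → ℤ} : m ∈ neighbors n ↔ siteNorm (n - m) = 1 := by
  simp only [neighbors, Finset.mem_filter, Finset.mem_Icc, Pi.le_def, and_iff_right_iff_imp]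
  intro h
  have h1 : ∀ i, |n i - m i| ≤ 1 := fun i => h ▸ abs_le_siteNorm (n - m) i
  exact ⟨fun i => by have := abs_le.1 (h1 i); omega, fun i => by have := abs_le.1 (h1 i); omega⟩

theorem mem_ball {d : ℕ} {R : ℝ} {n : Fin d → ℤ} : n ∈ ball d R ↔ (siteNorm n : ℝ) < R := by
  simp only [ball, Finset.mem_filter, Finset.mem_Icc, Pi.le_def, and_iff_right_iff_imp]
  intro h
  have h1 : siteNorm n ≤ ⌈R⌉ := by exact_mod_cast h.le.trans (Int.le_ceil R)
  have h2 : ∀ i, |n i| ≤ ⌈R⌉ := fun i => (abs_le_siteNorm n i).trans h1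
  exact ⟨fun i => (abs_le.1 (h2 i)).1, fun i => (abs_le.1 (h2 i)).2⟩

theorem mem_neighbors_comm {d : ℕ} {n m : Fin d → ℤ} : m ∈ neighbors n ↔ n ∈ neighbors m := by
  simp only [mem_neighbors, siteNorm, Pi.sub_apply]
  simp_rw [abs_sub_comm]

theorem card_neighbors_le {d : ℕ} (n : Fin d → ℤ) : (neighbors n).card ≤ 3 ^ d := by
  refine (Finset.card_filter_le _ _).trans (le_of_eq ?_)
  rw [Pi.card_Icc]
  have : ∀ i, (Finset.Icc (n i - 1) (n i + 1)).card = 3 := fun i => by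
    rw [Int.card_Icc]; omega
  simp [this]

/-- The expression `((Δ + V)ψ)(n) = ∑_{|n - m| = 1} ψ(m) + V(n) ψ(n)` for an arbitrary function `ψ`
on the lattice. -/
def action {d : ℕ} (V : (Fin d → ℤ) → ℝ) :
    ((Fin d → ℤ) → ℂ) →ₗ[ℂ] ((Fin d → ℤ) → ℂ) where
  toFun ψ n := ∑ m ∈ neighbors n, ψ m + (V n : ℂ) * ψ n
  map_add' φ ψ := by
    funext n
    simp only [Pi.add_apply, Finset.sum_add_distrib]
    ring
  map_smul' c ψ := by
    funext n
    simp only [Pi.smul_apply, smul_eq_mul, ← Finset.mul_sum, RingHom.id_apply]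
    ring

/-- The operator `H = Δ + V` on `ℓ²(ℤ^d)` with its natural domain `{ψ ∈ ℓ² | (Δ + V)ψ ∈ ℓ²}`,
which is the domain of the multiplication by `V`. -/
def hamiltonian {d : ℕ} (V : (Fin d → ℤ) → ℝ) : L2 d →ₗ.[ℂ] L2 d where
  domain :=
    { carrier := {ψ | Memℓp (action V ψ) 2}
      add_mem' := fun {φ ψ} hφ hψ => by
        simp only [Set.mem_ofPred_eq, lp.coeFn_add, map_add] at *
        exact hφ.add hψ
      zero_mem' := by
        simp only [Set.mem_ofPred_eq, lp.coeFn_zero, map_zero]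
        exact zero_memℓp
      smul_mem' := fun c ψ hψ => by
        simp only [Set.mem_ofPred_eq, lp.coeFn_smul, map_smul] at *
        exact hψ.const_smul c }
  toFun :=
    { toFun := fun ψ => ⟨action V ψ.1, ψ.2⟩
      map_add' := fun φ ψ => lp.ext (map_add (action V) (φ.1 : (Fin d → ℤ) → ℂ) ψ.1)
      map_smul' := fun c ψ => lp.ext (map_smul (action V) c (ψ.1 : (Fin d → ℤ) → ℂ)) }

theorem hamiltonian_apply {d : ℕ} (V : (Fin d → ℤ) → ℝ) (ψ : (hamiltonian V).domain) :
    ((hamiltonian V ψ : L2 d) : (Fin d → ℤ) → ℂ) = action V (ψ : L2 d) := rfl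

theorem memlp_of_finite {d : ℕ} {f : (Fin d → ℤ) → ℂ} (hf : f.support.Finite) : Memℓp f 2 :=
  (memℓp_zero_iff.2 hf).of_exponent_ge zero_le

theorem action_support_finite {d : ℕ} (V : (Fin d → ℤ) → ℝ) {f : (Fin d → ℤ) → ℂ}
    (hf : f.support.Finite) : (action V f).support.Finite := by
  classical
  refine ((hf.toFinset.biUnion neighbors ∪ hf.toFinset).finite_toSet).subset fun n hn => ?_
  by_contra h
  simp only [Finset.coe_union, Finset.coe_biUnion, Set.mem_union, Set.mem_iUnion, Finset.mem_coe,
    Set.Finite.mem_toFinset, Function.mem_support, not_or, not_exists, not_not] at h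
  refine hn ?_
  change ∑ m ∈ neighbors n, f m + (V n : ℂ) * f n = 0
  rw [h.2, mul_zero, add_zero]
  refine Finset.sum_eq_zero fun m hm => ?_
  by_contra hm'
  exact h.1 m hm' (mem_neighbors_comm.1 hm)

theorem mem_domain_of_finite {d : ℕ} (V : (Fin d → ℤ) → ℝ) {f : L2 d}
    (hf : (f : (Fin d → ℤ) → ℂ).support.Finite) : f ∈ (hamiltonian V).domain :=
  memlp_of_finite (action_support_finite V hf)

/-- The vector `δ_n`, as an element of the domain of `H`. -/
def delta {d : ℕ} (V : (Fin d → ℤ) → ℝ) (n : Fin d → ℤ) : (hamiltonian V).domain :=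
  ⟨lp.single 2 n 1, mem_domain_of_finite V
    ((Set.finite_singleton n).subset fun m hm => by
      by_contra h
      exact hm (lp.single_apply_ne (E := fun _ : Fin d → ℤ => ℂ) 2 n 1 h))⟩

theorem finite_spectral {W : Type*} [NormedAddCommGroup W] [InnerProductSpace ℂ W]
    [FiniteDimensional ℂ W] (T : W →ₗ[ℂ] W) (hT : T.IsSymmetric) (ψ : W) :
    ∃ μ : FiniteMeasure ℝ, (μ.mass : ℝ) ≤ ‖ψ‖ ^ 2 ∧
      (∀ r : ℝ, 0 < r → (μ (Metric.closedBall 0 r)ᶜ : ℝ) ≤ ‖T ψ‖ ^ 2 / r ^ 2) ∧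
      ∀ z : ℂ, z.im ≠ 0 → ∀ g : W,
        ‖inner ℂ ψ g - ∫ x, ((x : ℂ) - z)⁻¹ ∂(μ : Measure ℝ)‖
          ≤ ‖ψ‖ * (‖T g - z • g - ψ‖ / |z.im|) := by
  classical
  let b := hT.eigenvectorBasis rfl
  let l := hT.eigenvalues rfl
  have hb : ∀ (v : W) i, b.repr (T v) i = (l i : ℂ) * b.repr v i :=
    fun v i => hT.eigenvectorBasis_apply_self_apply rfl v i
  have hn : ∀ v : W, ∑ i, ‖b.repr v i‖ ^ 2 = ‖v‖ ^ 2 := fun v => by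
    rw [← b.repr.norm_map v, EuclideanSpace.norm_sq_eq]
  let c : Fin (Module.finrank ℂ W) → NNReal := fun i => ‖b.repr ψ i‖₊ ^ 2
  have hc : ∀ i, (c i : ℝ) = ‖b.repr ψ i‖ ^ 2 := fun i => by simp [c]
  let ν : Measure ℝ := ∑ i, c i • Measure.dirac (l i)
  have : IsFiniteMeasure ν := by infer_instance
  have hset : ∀ s : Set ℝ, MeasurableSet s →
      (ν s).toReal = ∑ i, ‖b.repr ψ i‖ ^ 2 * s.indicator 1 (l i) := fun s hs => by
    simp only [ν, Measure.coe_finsetSum, Finset.sum_apply, Measure.smul_apply]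
    rw [ENNReal.toReal_sum]
    · refine Finset.sum_congr rfl fun i _ => ?_
      rw [Measure.dirac_apply' _ hs, ← hc i]
      by_cases h : l i ∈ s <;> simp [h, ENNReal.smul_def]
    · intro i _
      exact (measure_lt_top (c i • Measure.dirac (l i)) s).ne
  refine ⟨⟨ν, this⟩, ?_, ?_, ?_⟩
  · change (ν Set.univ).toReal ≤ _
    rw [hset _ MeasurableSet.univ, ← hn ψ]
    simp
  · intro r hr
    change (ν _).toReal ≤ _
    rw [hset _ Metric.isClosed_closedBall.measurableSet.compl, ← hn, Finset.sum_div]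
    refine Finset.sum_le_sum fun i _ => ?_
    rw [hb, le_div_iff₀ (by positivity), norm_mul, mul_pow]
    by_cases h : l i ∈ (Metric.closedBall (0 : ℝ) r)ᶜ
    · have h1 : r < |l i| := by simpa using h
      have h2 : r ^ 2 ≤ |l i| ^ 2 := by gcongr
      simp only [h, Set.indicator_of_mem, Pi.one_apply, mul_one]
      rw [mul_comm]
      simp only [Complex.norm_real, Real.norm_eq_abs]
      gcongr
    · simp only [h, not_false_eq_true, Set.indicator_of_notMem, mul_zero, zero_mul]
      positivity
  · intro z hz g
    have hne : ∀ i, (l i : ℂ) - z ≠ 0 := fun i h => hz (by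
      have := congrArg Complex.im h
      simpa using this)
    have hle : ∀ i, |z.im| ≤ ‖(l i : ℂ) - z‖ := fun i => by
      have := Complex.abs_im_le_norm ((l i : ℂ) - z)
      simpa using this
    have hpos : 0 < |z.im| := abs_pos.2 hz
    have hint : ∫ x, ((x : ℂ) - z)⁻¹ ∂ν
        = ∑ i, (starRingEnd ℂ) (b.repr ψ i) * (b.repr ψ i * ((l i : ℂ) - z)⁻¹) := by
      rw [integral_finsetSum_measure]
      · refine Finset.sum_congr rfl fun i _ => ?_
        rw [integral_smul_nnreal_measure, integral_dirac, ← mul_assoc, Complex.conj_mul']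
        rw [NNReal.smul_def, hc, Complex.real_smul]
        push_cast
        rfl
      · intro i _
        exact (integrable_dirac (by simp)).smul_measure_nnreal
    let e := T g - z • g - ψ
    have he : ∀ i, b.repr g i - b.repr ψ i * ((l i : ℂ) - z)⁻¹
        = b.repr e i * ((l i : ℂ) - z)⁻¹ := fun i => by
      have : b.repr e i = (l i : ℂ) * b.repr g i - z * b.repr g i - b.repr ψ i := by
        simp [e, hb]
      rw [this]
      field_simp [hne i]
    change ‖inner ℂ ψ g - ∫ x, ((x : ℂ) - z)⁻¹ ∂ν‖ ≤ _
    let w : EuclideanSpace ℂ (Fin (Module.finrank ℂ W)) :=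
      WithLp.toLp 2 fun i => b.repr e i * ((l i : ℂ) - z)⁻¹
    have hw : inner ℂ ψ g - ∫ x, ((x : ℂ) - z)⁻¹ ∂ν = inner ℂ (b.repr ψ) w := by
      rw [hint, ← b.repr.inner_map_map ψ g, PiLp.inner_apply, PiLp.inner_apply,
        ← Finset.sum_sub_distrib]
      refine Finset.sum_congr rfl fun i _ => ?_
      simp only [RCLike.inner_apply, w]
      rw [← he i]
      ring
    rw [hw]
    refine (norm_inner_le_norm _ _).trans ?_
    rw [b.repr.norm_map]
    gcongr
    rw [← sq_le_sq₀ (norm_nonneg _) (by positivity), EuclideanSpace.norm_sq_eq, div_pow, ← hn,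
      Finset.sum_div]
    refine Finset.sum_le_sum fun i _ => ?_
    simp only [w, norm_mul, norm_inv, mul_pow, inv_pow]
    rw [div_eq_mul_inv]
    have := hle i
    gcongr

/-- `μ` is the spectral measure of the vector `ψ` and the self-adjoint operator `H`: a finite Borel
measure on `ℝ` with `⟨(H - z)⁻¹ψ, ψ⟩ = ∫ dμ(x) / (x - z)` for all non-real `z`. -/
def IsSpectralMeasure {E : Type*} [NormedAddCommGroup E] [InnerProductSpace ℂ E]
    (H : E →ₗ.[ℂ] E) (ψ : E) (μ : Measure ℝ) : Prop :=
  IsFiniteMeasure μ ∧ ∀ z : ℂ, z.im ≠ 0 → ∀ g : H.domain, H g - z • (g : E) = ψ →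
    inner ℂ ψ (g : E) = ∫ x : ℝ, ((x : ℂ) - z)⁻¹ ∂μ

/-- The restriction of a function on the lattice to a finite set of sites. -/
def restr {d : ℕ} (F : Finset (Fin d → ℤ)) (ψ : (Fin d → ℤ) → ℂ) : EuclideanSpace ℂ F :=
  WithLp.toLp 2 fun n => ψ n

/-- The matrix of `Δ + V` on a finite set of sites. -/
def boxMatrix {d : ℕ} (V : (Fin d → ℤ) → ℝ) (F : Finset (Fin d → ℤ)) : Matrix F F ℂ :=
  fun n m => (if m.1 ∈ neighbors n.1 then 1 else 0) + if m = n then (V n : ℂ) else 0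

theorem boxMatrix_isHermitian {d : ℕ} (V : (Fin d → ℤ) → ℝ) (F : Finset (Fin d → ℤ)) :
    (boxMatrix V F).IsHermitian := by
  ext n m
  simp only [Matrix.conjTranspose_apply, boxMatrix, star_add, apply_ite (star : ℂ → ℂ), star_one,
    star_zero]
  congr 1
  · simp only [mem_neighbors_comm]
  · by_cases h : n = m
    · subst h; simp
    · simp [h, Ne.symm h]

theorem norm_restr_sq {d : ℕ} (F : Finset (Fin d → ℤ)) (ψ : (Fin d → ℤ) → ℂ) :
    ‖restr F ψ‖ ^ 2 = ∑ n ∈ F, ‖ψ n‖ ^ 2 := by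
  rw [EuclideanSpace.norm_sq_eq, ← Finset.sum_coe_sort F fun n => ‖ψ n‖ ^ 2]
  rfl

theorem hasSum_norm_sq {d : ℕ} (ψ : L2 d) : HasSum (fun n => ‖ψ n‖ ^ 2) (‖ψ‖ ^ 2) := by
  have h := lp.hasSum_norm (p := 2) (by norm_num) ψ
  simpa using h

theorem norm_restr_le {d : ℕ} (F : Finset (Fin d → ℤ)) (ψ : L2 d) : ‖restr F ψ‖ ≤ ‖ψ‖ := by
  rw [← sq_le_sq₀ (norm_nonneg _) (norm_nonneg _), norm_restr_sq]
  exact sum_le_hasSum _ (fun _ _ => by positivity) (hasSum_norm_sq ψ)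

theorem tendsto_inner_restr {d : ℕ} (φ ψ : L2 d) :
    Tendsto (fun F => inner ℂ (restr F φ) (restr F ψ)) atTop (𝓝 (inner ℂ φ ψ)) := by
  have h : HasSum _ _ := lp.hasSum_inner (𝕜 := ℂ) φ ψ
  refine Tendsto.congr (fun F => ?_) h
  rw [PiLp.inner_apply, ← Finset.sum_coe_sort F]
  rfl

theorem boxMatrix_error {d : ℕ} (V : (Fin d → ℤ) → ℝ) (F : Finset (Fin d → ℤ)) (g : L2 d) :
    ‖Matrix.toEuclideanLin (boxMatrix V F) (restr F g) - restr F (action V g)‖ ^ 2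
      ≤ (3 ^ d) ^ 2 * (‖g‖ ^ 2 - ‖restr F g‖ ^ 2) := by
  classical
  have hdiff : Matrix.toEuclideanLin (boxMatrix V F) (restr F g) - restr F (action V g)
      = restr F fun n => -∑ m ∈ neighbors n \ F, g m := by
    ext n
    have h1 : (Matrix.toEuclideanLin (boxMatrix V F) (restr F g)) n
        = ∑ m ∈ neighbors n.1 ∩ F, g m + (V n : ℂ) * g n := by
      have : (Matrix.toEuclideanLin (boxMatrix V F) (restr F g)) n
        = ∑ m : F, boxMatrix V F n m * g m := rfl
      rw [this]
      simp only [boxMatrix, add_mul, Finset.sum_add_distrib, ite_mul, one_mul, zero_mul]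
      congr 1
      · rw [Finset.sum_coe_sort F fun m => if m ∈ neighbors n.1 then g m else 0,
          ← Finset.sum_filter, Finset.filter_mem_eq_inter, Finset.inter_comm]
      · simp
    have h2 : restr F (action V g) n = ∑ m ∈ neighbors n.1, g m + (V n : ℂ) * g n := rfl
    rw [PiLp.sub_apply, h1, h2, ← Finset.sum_inter_add_sum_sdiff (neighbors n.1) F]
    simp only [restr]
    ring
  rw [hdiff, norm_restr_sq]
  have hcs : ∀ n, ‖-∑ m ∈ neighbors n \ F, g m‖ ^ 2 ≤ 3 ^ d * ∑ m ∈ neighbors n \ F, ‖g m‖ ^ 2 := by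
    intro n
    rw [norm_neg]
    calc ‖∑ m ∈ neighbors n \ F, g m‖ ^ 2 ≤ (∑ m ∈ neighbors n \ F, ‖g m‖) ^ 2 := by
          gcongr; exact norm_sum_le _ _
      _ ≤ (neighbors n \ F).card * ∑ m ∈ neighbors n \ F, ‖g m‖ ^ 2 := sq_sum_le_card_mul_sum_sq
      _ ≤ 3 ^ d * ∑ m ∈ neighbors n \ F, ‖g m‖ ^ 2 := by
          gcongr
          exact_mod_cast (Finset.card_le_card Finset.sdiff_subset).trans (card_neighbors_le n)
  let G := F.biUnion neighbors
  have hswap : ∑ n ∈ F, ∑ m ∈ neighbors n \ F, ‖g m‖ ^ 2 ≤ 3 ^ d * ∑ m ∈ G \ F, ‖g m‖ ^ 2 := by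
    have : ∑ n ∈ F, ∑ m ∈ neighbors n \ F, ‖g m‖ ^ 2
        = ∑ m ∈ G \ F, ∑ n ∈ F with m ∈ neighbors n, ‖g m‖ ^ 2 := by
      refine Finset.sum_comm' fun n m => ?_
      simp only [Finset.mem_sdiff, Finset.mem_filter, G, Finset.mem_biUnion]
      constructor
      · rintro ⟨h1, h2, h3⟩
        exact ⟨⟨h1, h2⟩, ⟨n, h1, h2⟩, h3⟩
      · rintro ⟨⟨h1, h2⟩, _, h3⟩
        exact ⟨h1, h2, h3⟩
    rw [this, Finset.mul_sum]
    refine Finset.sum_le_sum fun m _ => ?_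
    rw [Finset.sum_const, nsmul_eq_mul]
    gcongr
    have : {n ∈ F | m ∈ neighbors n} ⊆ neighbors m := fun n hn =>
      mem_neighbors_comm.1 (Finset.mem_filter.1 hn).2
    exact_mod_cast (Finset.card_le_card this).trans (card_neighbors_le m)
  have htail : ∑ m ∈ G \ F, ‖g m‖ ^ 2 ≤ ‖g‖ ^ 2 - ‖restr F g‖ ^ 2 := by
    rw [norm_restr_sq, le_sub_iff_add_le, ← Finset.sum_union Finset.sdiff_disjoint]
    exact sum_le_hasSum _ (fun _ _ => by positivity) (hasSum_norm_sq g)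
  calc ∑ n ∈ F, ‖-∑ m ∈ neighbors n \ F, g m‖ ^ 2
      ≤ ∑ n ∈ F, 3 ^ d * ∑ m ∈ neighbors n \ F, ‖g m‖ ^ 2 := Finset.sum_le_sum fun n _ => hcs n
    _ = 3 ^ d * ∑ n ∈ F, ∑ m ∈ neighbors n \ F, ‖g m‖ ^ 2 := by rw [Finset.mul_sum]
    _ ≤ 3 ^ d * (3 ^ d * (‖g‖ ^ 2 - ‖restr F g‖ ^ 2)) := by
        gcongr
        exact hswap.trans (by gcongr)
    _ = _ := by ring

/-- Every vector in the domain of `H = Δ + V` has a spectral measure. It is a weak limit of spectral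
measures of the restrictions of `H` to finite sets of sites. -/
theorem exists_isSpectralMeasure {d : ℕ} (V : (Fin d → ℤ) → ℝ) (ψ : (hamiltonian V).domain) :
    ∃ μ : Measure ℝ, IsSpectralMeasure (hamiltonian V) (ψ : L2 d) μ := by
  let T := fun F : Finset (Fin d → ℤ) => Matrix.toEuclideanLin (boxMatrix V F)
  have hT : ∀ F, (T F).IsSymmetric := fun F =>
    Matrix.isSymmetric_toEuclideanLin_iff.2 (boxMatrix_isHermitian V F)
  choose μ hμ1 hμ2 hμ3 using fun F => finite_spectral (T F) (hT F) (restr F (ψ : L2 d))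
  set B : ℝ := ‖hamiltonian V ψ‖ + 3 ^ d * ‖(ψ : L2 d)‖
  have hB : ∀ F, ‖T F (restr F (ψ : L2 d))‖ ≤ B := fun F => by
    have h1 : ‖T F (restr F (ψ : L2 d)) - restr F (action V (ψ : L2 d))‖ ≤ 3 ^ d * ‖(ψ : L2 d)‖ := by
      rw [← sq_le_sq₀ (norm_nonneg _) (by positivity), mul_pow]
      refine (boxMatrix_error V F ψ).trans ?_
      gcongr
      linarith [sq_nonneg ‖restr F (ψ : L2 d)‖]
    have h2 : ‖restr F (action V (ψ : L2 d))‖ ≤ ‖hamiltonian V ψ‖ := norm_restr_le F (hamiltonian V ψ)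
    have h3 := norm_le_insert' (T F (restr F (ψ : L2 d))) (restr F (action V (ψ : L2 d)))
    linarith
  let u : ℕ → NNReal := fun n => (B ^ 2 / ((n : ℝ) + 1) ^ 2).toNNReal
  have hu : Tendsto u atTop (𝓝 0) := by
    have : Tendsto (fun n : ℕ => B ^ 2 / ((n : ℝ) + 1) ^ 2) atTop (𝓝 0) := by
      have h1 : Tendsto (fun n : ℕ => ((n : ℝ) + 1) ^ 2) atTop atTop :=
        (tendsto_pow_atTop (by norm_num)).comp
          (tendsto_atTop_add_const_right _ _ tendsto_natCast_atTop_atTop)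
      exact h1.const_div_atTop _
    have h2 := (continuous_real_toNNReal.tendsto 0).comp this
    rwa [Real.toNNReal_zero] at h2
  have hK := isCompact_setOfPred_finiteMeasure_mass_le_compl_isCompact_le
    (K := fun n : ℕ => Metric.closedBall (0 : ℝ) ((n : ℝ) + 1)) (‖(ψ : L2 d)‖₊ ^ 2) hu
    (fun n => isCompact_closedBall _ _) (Or.inl inferInstance)
  let 𝒰 : Ultrafilter (Finset (Fin d → ℤ)) := Ultrafilter.of atTop
  have h𝒰 : (𝒰 : Filter (Finset (Fin d → ℤ))) ≤ atTop := Ultrafilter.of_le _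
  obtain ⟨ν, -, hν⟩ := hK.ultrafilter_le_nhds (𝒰.map μ) (by
    rw [Ultrafilter.coe_map, le_principal_iff, Filter.mem_map]
    refine Filter.univ_mem' fun F => ?_
    refine ⟨?_, fun n => ?_⟩
    · rw [← NNReal.coe_le_coe]
      refine (hμ1 F).trans ?_
      push_cast
      gcongr
      exact norm_restr_le F ψ
    · rw [← NNReal.coe_le_coe]
      refine (hμ2 F _ (by positivity)).trans ?_
      simp only [u]
      rw [Real.coe_toNNReal _ (by positivity)]
      gcongr
      exact hB F)
  have hν' : Tendsto μ 𝒰 (𝓝 ν) := hν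
  refine ⟨ν, inferInstance, fun z hz g hg => ?_⟩
  have hne : ∀ x : ℝ, (x : ℂ) - z ≠ 0 := fun x h => hz (by simpa using congrArg Complex.im h)
  let f : BoundedContinuousFunction ℝ ℂ := BoundedContinuousFunction.ofNormedAddCommGroup
    (fun x : ℝ => ((x : ℂ) - z)⁻¹)
    (by fun_prop (disch := exact hne _)) |z.im|⁻¹ (fun x => by
      rw [norm_inv]
      gcongr
      simpa using Complex.abs_im_le_norm ((x : ℂ) - z))
  have hlim1 : Tendsto (fun F => ∫ x, ((x : ℂ) - z)⁻¹ ∂(μ F : Measure ℝ)) 𝒰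
      (𝓝 (∫ x, ((x : ℂ) - z)⁻¹ ∂(ν : Measure ℝ))) :=
    (FiniteMeasure.tendsto_iff_forall_integral_rclike_tendsto ℂ).1 hν' f
  have hlim2 := (tendsto_inner_restr (ψ : L2 d) (g : L2 d)).mono_left h𝒰
  have herr : ∀ F, ‖T F (restr F (g : L2 d)) - z • restr F (g : L2 d) - restr F (ψ : L2 d)‖
      ≤ √((3 ^ d) ^ 2 * (‖(g : L2 d)‖ ^ 2 - ‖restr F (g : L2 d)‖ ^ 2)) := fun F => by
    refine Real.le_sqrt_of_sq_le ((le_of_eq ?_).trans (boxMatrix_error V F g))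
    congr 2
    have : restr F (action V (g : L2 d)) = z • restr F (g : L2 d) + restr F (ψ : L2 d) := by
      ext n
      have h := congrArg (fun φ : L2 d => φ n) hg
      have h' : action V (g : L2 d) n - z * (g : L2 d) n = (ψ : L2 d) n := h
      change action V (g : L2 d) n = z * (g : L2 d) n + (ψ : L2 d) n
      rw [← h']
      ring
    rw [this]
    abel
  have hlim3 : Tendsto (fun F => inner ℂ (restr F (ψ : L2 d)) (restr F (g : L2 d))
      - ∫ x, ((x : ℂ) - z)⁻¹ ∂(μ F : Measure ℝ)) 𝒰 (𝓝 0) := by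
    refine Tendsto.mono_left ?_ h𝒰
    have hnorm : Tendsto (fun F => ‖restr F (g : L2 d)‖ ^ 2) atTop (𝓝 (‖(g : L2 d)‖ ^ 2)) := by
      have h : HasSum _ _ := hasSum_norm_sq (g : L2 d)
      exact Tendsto.congr (fun F => (norm_restr_sq F _).symm) h
    have hb : Tendsto (fun F => ‖(ψ : L2 d)‖
        * (√((3 ^ d) ^ 2 * (‖(g : L2 d)‖ ^ 2 - ‖restr F (g : L2 d)‖ ^ 2)) / |z.im|))
        atTop (𝓝 0) := by
      have := ((((hnorm.const_sub (‖(g : L2 d)‖ ^ 2)).const_mul ((3 ^ d : ℝ) ^ 2)).sqrt).div_const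
        |z.im|).const_mul ‖(ψ : L2 d)‖
      simpa using this
    refine squeeze_zero_norm (fun F => (hμ3 F z hz (restr F (g : L2 d))).trans ?_) hb
    have := herr F
    have := norm_restr_le F (ψ : L2 d)
    gcongr
  have := tendsto_nhds_unique hlim3 (hlim2.sub hlim1)
  exact (sub_eq_zero.1 this.symm)

/-- The spectral measure `μ_ψ` of a vector `ψ` in the domain of `H = Δ + V`. -/
def spectralMeasure {d : ℕ} (V : (Fin d → ℤ) → ℝ) (ψ : (hamiltonian V).domain) : Measure ℝ :=
  (exists_isSpectralMeasure V ψ).choose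

theorem spectralMeasure_spec {d : ℕ} (V : (Fin d → ℤ) → ℝ) (ψ : (hamiltonian V).domain) :
    IsSpectralMeasure (hamiltonian V) (ψ : L2 d) (spectralMeasure V ψ) :=
  (exists_isSpectralMeasure V ψ).choose_spec

/-- The matrix element `⟨φ, f(H)ψ⟩` of the functional calculus of `H = Δ + V`, for a bounded
measurable `f`. It is obtained by polarization from `⟨ψ, f(H)ψ⟩ = ∫ f dμ_ψ`. -/
def matrixElement {d : ℕ} (V : (Fin d → ℤ) → ℝ) (f : ℝ → ℂ) (φ ψ : (hamiltonian V).domain) : ℂ :=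
  (1 / 4) * ∑ k ∈ Finset.range 4,
    (-Complex.I) ^ k * ∫ x, f x ∂spectralMeasure V (φ + Complex.I ^ k • ψ)

/-- The wavepacket `e^{-iHt}δ_0`, through its coordinates `⟨δ_n, e^{-iHt}δ_0⟩`. -/
def wavepacket {d : ℕ} (V : (Fin d → ℤ) → ℝ) (t : ℝ) (n : Fin d → ℤ) : ℂ :=
  matrixElement V (fun x => Complex.exp (-Complex.I * x * t)) (delta V n) (delta V 0)

/-- `‖χ_R ψ‖²`, with `χ_R` the projection on the sites `n` with `|n| < R`. -/
def ballWeight {d : ℕ} (R : ℝ) (ψ : (Fin d → ℤ) → ℂ) : ℝ := ∑ n ∈ ball d R, ‖ψ n‖ ^ 2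

/-- The time average `(2/T) ∫₀^∞ e^{-2t/T} A(t) dt`. -/
def timeAverage (T : ℝ) (A : ℝ → ℝ) : ℝ :=
  2 / T * ∫ t in Set.Ioi (0 : ℝ), Real.exp (-2 * t / T) * A t

/-! ### The length scale of a Jacobi matrix -/

/-- The solution `u_θ` of `a(n)u(n+1) + a(n-1)u(n-1) + b(n)u(n) = E u(n)`, `n ≥ 1`, with
`u(0) = sin θ`, `u(1) = cos θ`. -/
def jacobiSolution (a b : ℕ → ℝ) (E θ : ℝ) : ℕ → ℝ
  | 0 => Real.sin θ
  | 1 => Real.cos θ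
  | n + 2 => ((E - b (n + 1)) * jacobiSolution a b E θ (n + 1)
      - a n * jacobiSolution a b E θ n) / a (n + 1)

/-- The norm `‖u‖_ℓ`, where `‖u‖_ℓ² = ∑_{n=1}^{⌊ℓ⌋} |u(n)|² + (ℓ - ⌊ℓ⌋)|u(⌊ℓ⌋ + 1)|²`. -/
def truncNorm (ℓ : ℝ) (u : ℕ → ℝ) : ℝ :=
  √(∑ n ∈ Finset.Icc 1 ⌊ℓ⌋₊, |u n| ^ 2 + (ℓ - ⌊ℓ⌋₊) * |u (⌊ℓ⌋₊ + 1)| ^ 2)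

/-- The scale `L⁺_ε(E)`: the number `ℓ ≥ 0` with `max_θ ‖u_θ‖_ℓ · min_θ ‖u_θ‖_ℓ = 1/ε`. If
`a` does not vanish, there is at most one such `ℓ`; the scale is `∞` if there is none. -/
def lengthScale (a b : ℕ → ℝ) (ε E : ℝ) : ENNReal :=
  sInf {x | ∃ ℓ : ℝ, 0 ≤ ℓ ∧ x = ENNReal.ofReal ℓ ∧
    (⨆ θ : ℝ, truncNorm ℓ (jacobiSolution a b E θ)) *
      (⨅ θ : ℝ, truncNorm ℓ (jacobiSolution a b E θ)) = ε⁻¹}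

/-! ### The orthonormal polynomial representation -/

theorem iterate_support_finite {d : ℕ} (V : (Fin d → ℤ) → ℝ) (k : ℕ) :
    ((action V)^[k] (Pi.single 0 1)).support.Finite := by
  induction k with
  | zero =>
    refine (Set.finite_singleton (0 : Fin d → ℤ)).subset fun m hm => ?_
    by_contra h
    exact hm (Pi.single_eq_of_ne h 1)
  | succ k ih =>
    rw [Function.iterate_succ_apply']
    exact action_support_finite V ih

/-- The moment vector `H^k δ_0`. -/
def moment {d : ℕ} (V : (Fin d → ℤ) → ℝ) (k : ℕ) : L2 d :=
  ⟨(action V)^[k] (Pi.single 0 1), memlp_of_finite (iterate_support_finite V k)⟩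

/-- The orthonormal vectors `ρ_0, ρ_1, …` obtained from `δ_0, Hδ_0, H²δ_0, …` by the Gram-Schmidt
procedure. -/
def rho {d : ℕ} (V : (Fin d → ℤ) → ℝ) (k : ℕ) : L2 d :=
  InnerProductSpace.gramSchmidtNormed ℂ (moment V) k

theorem rho_mem_domain {d : ℕ} (V : (Fin d → ℤ) → ℝ) (k : ℕ) : rho V k ∈ (hamiltonian V).domain := by
  refine Submodule.smul_mem _ _ ?_
  refine Submodule.span_le.2 ?_
    (InnerProductSpace.gramSchmidt_mem_span ℂ (moment V) (le_refl k))
  rintro _ ⟨j, -, rfl⟩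
  exact mem_domain_of_finite V (iterate_support_finite V j)

/-- The matrix element `⟨ρ_j, Hρ_k⟩`; it is real. -/
def rhoEntry {d : ℕ} (V : (Fin d → ℤ) → ℝ) (j k : ℕ) : ℝ :=
  (inner ℂ (rho V j) (hamiltonian V ⟨rho V k, rho_mem_domain V k⟩)).re

/-- The off-diagonal entries of the orthonormal polynomial representation, in which `ρ_n` is
identified with `δ_{n+1}`: `a(n) = ⟨ρ_n, Hρ_{n-1}⟩` for `n ≥ 1`, and `a(0) = 1`. -/
def polyA {d : ℕ} (V : (Fin d → ℤ) → ℝ) : ℕ → ℝ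
  | 0 => 1
  | n + 1 => rhoEntry V (n + 1) n

/-- The diagonal entries `b(n) = ⟨ρ_{n-1}, Hρ_{n-1}⟩`, `n ≥ 1`; the value `b(0)` is not used. -/
def polyB {d : ℕ} (V : (Fin d → ℤ) → ℝ) : ℕ → ℝ
  | 0 => 0
  | n + 1 => rhoEntry V n n

end Lattice
end

noncomputable section

namespace Lattice

/-! ### Solutions of a Jacobi recurrence and the length scale. -/

section JacobiSolutions

/-! Put `ε = 1/T` and let `g = (H - z)⁻¹δ_0` with `Im z = ε`. The Fourier transform in time of the
damped amplitude `e^{-εt}⟨δ_n, e^{-iHt}δ_0⟩` is `-i g(n)`, so by Plancherel the averaged weight of a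
ball is a constant times `ε ∫ ∑ |g(n)|²`, with the sum over the ball and the integral over `Re z`
(`fourier_damped`, `ofReal_timeAverage_ballWeight`). On the other side, `Im ⟨δ_0, g⟩` is the Poisson
integral of `μ`, and integrating it over all `Re z` within `ε` of a set `S` gives at least a
constant times `μ(S)` (`measure_le_lintegral_poisson`). It therefore suffices to prove, for each `z`
with `Re z` within `ε` of an energy `E` of length scale at most `L`, that `Im ⟨δ_0, g⟩ ≤ 5ε ∑
|g(n)|²`, summed over `|n| < L + 1` (`im_le_sum_fourier`).

The pointwise bound is one-dimensional. The coefficients `G(n+1) = ⟨ρ_n, g⟩`, with `G(0) = -1`,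
solve the Jacobi recurrence at energy `z`. Let `u` and `v` be the solutions at `E` with `θ = 0` and
`θ = π/2`. Variation of parameters gives `-v + G(1)u = G - (z - E)KG`, where `K` is the triangular
kernel `u(n)v(k) - v(n)u(k)`. The determinant `D` of the Gram matrix of `u, v` in the truncated norm
plays two roles. It controls the Hilbert-Schmidt norm of `K`, by Lagrange's identity. It also bounds
`‖-v + G(1)u‖²` from below by `2√D · Im G(1)`. The product of the maximum and the minimum over `θ`
is exactly `√D`, so at the length scale `√D = 1/ε`. Combining the two gives `Im G(1) ≤ 5ε‖G‖²`
(`im_le_of_lengthScale`).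

The dimension enters only through two facts: `ρ_k` lives on `|n| ≤ k`, so Bessel's inequality bounds
`‖G‖²` by the weight of `g` in the ball (`sum_rhoCoeff_le`), and the moments `H^kδ_0` are linearly
independent for `d ≥ 1`, so no `a(n)` vanishes. Strictness holds because the time average is
positive. -/

theorem iSup_mul_iInf_sqrt_form {A B C : ℝ} (hA : 0 ≤ A) (hB : 0 ≤ B) (h : C ^ 2 ≤ A * B)
    (q : ℝ → ℝ) (hq : ∀ θ, q θ = √(B * Real.sin θ ^ 2 + 2 * C * (Real.sin θ * Real.cos θ)
      + A * Real.cos θ ^ 2)) :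
    (⨆ θ, q θ) * (⨅ θ, q θ) = √(A * B - C ^ 2) := by
  -- In the double angle the form is `(A + B)/2 + r cos(2θ - φ)` with `r e^{iφ} = ζ`. Its extreme
  -- values `(A + B)/2 ± r` are the eigenvalues of the Gram matrix, and their product is the
  -- determinant.
  set ζ : ℂ := ⟨(A - B) / 2, C⟩
  set r := ‖ζ‖
  set φ := ζ.arg
  have h1 : r * Real.cos φ = (A - B) / 2 := Complex.norm_mul_cos_arg ζ
  have h2 : r * Real.sin φ = C := Complex.norm_mul_sin_arg ζ
  have hr : 0 ≤ r := norm_nonneg _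
  have hr2 : r ^ 2 = ((A - B) / 2) ^ 2 + C ^ 2 := by
    rw [← h1, ← h2]
    linear_combination -r ^ 2 * Real.sin_sq_add_cos_sq φ
  have hrM : r ≤ (A + B) / 2 := by
    rw [← sq_le_sq₀ hr (by positivity), hr2]
    nlinarith
  have hform : ∀ θ, q θ = √((A + B) / 2 + r * Real.cos (2 * θ - φ)) := fun θ => by
    rw [hq, Real.cos_sub, Real.cos_two_mul, Real.sin_two_mul]
    congr 1
    have hs := Real.sin_sq_add_cos_sq θ
    linear_combination B * hs
      - (2 * Real.cos θ ^ 2 - 1) * h1 - 2 * Real.sin θ * Real.cos θ * h2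
  have hmax : IsGreatest (Set.range q) √((A + B) / 2 + r) := by
    refine ⟨⟨φ / 2, ?_⟩, ?_⟩
    · rw [hform, show 2 * (φ / 2) - φ = 0 by ring, Real.cos_zero, mul_one]
    · rintro _ ⟨θ, rfl⟩
      rw [hform]
      gcongr
      nlinarith [Real.cos_le_one (2 * θ - φ)]
  have hmin : IsLeast (Set.range q) √((A + B) / 2 - r) := by
    refine ⟨⟨φ / 2 + Real.pi / 2, ?_⟩, ?_⟩
    · rw [hform, show 2 * (φ / 2 + Real.pi / 2) - φ = Real.pi by ring, Real.cos_pi]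
      ring_nf
    · rintro _ ⟨θ, rfl⟩
      rw [hform]
      gcongr
      nlinarith [Real.neg_one_le_cos (2 * θ - φ)]
  rw [iSup, iInf, hmax.csSup_eq, hmin.csInf_eq, ← Real.sqrt_mul (by positivity)]
  congr 1
  linear_combination -hr2

/-- The weights of the sites `1, …, ⌊ℓ⌋ + 1` in the truncated norm `‖u‖_ℓ`. -/
def truncWeight (ℓ : ℝ) (n : ℕ) : ℝ := if n ≤ ⌊ℓ⌋₊ then 1 else ℓ - ⌊ℓ⌋₊

theorem truncWeight_nonneg {ℓ : ℝ} (hℓ : 0 ≤ ℓ) (n : ℕ) : 0 ≤ truncWeight ℓ n := by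
  unfold truncWeight
  split_ifs
  · exact zero_le_one
  · exact sub_nonneg.2 (Nat.floor_le hℓ)

theorem truncWeight_le_one (ℓ : ℝ) (n : ℕ) : truncWeight ℓ n ≤ 1 := by
  unfold truncWeight
  split_ifs
  · exact le_rfl
  · linarith [Nat.lt_floor_add_one ℓ]

/-- The scalar product belonging to the truncated norm. -/
def truncInner (ℓ : ℝ) (u v : ℕ → ℝ) : ℝ :=
  ∑ n ∈ Finset.Icc 1 (⌊ℓ⌋₊ + 1), truncWeight ℓ n * (u n * v n)

theorem truncNorm_eq (ℓ : ℝ) (u : ℕ → ℝ) : truncNorm ℓ u = √(truncInner ℓ u u) := by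
  rw [truncNorm, truncInner, Finset.sum_Icc_succ_top (by omega)]
  congr 2
  · refine Finset.sum_congr rfl fun n hn => ?_
    rw [truncWeight, if_pos (Finset.mem_Icc.1 hn).2, sq_abs]
    ring
  · rw [truncWeight, if_neg (by omega), sq_abs]
    ring

theorem truncInner_self_nonneg {ℓ : ℝ} (hℓ : 0 ≤ ℓ) (u : ℕ → ℝ) : 0 ≤ truncInner ℓ u u :=
  Finset.sum_nonneg fun n _ => mul_nonneg (truncWeight_nonneg hℓ n) (mul_self_nonneg _)

/-- Lagrange's identity for the truncated scalar product. -/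
theorem truncInner_lagrange (ℓ : ℝ) (u v : ℕ → ℝ) :
    ∑ n ∈ Finset.Icc 1 (⌊ℓ⌋₊ + 1), ∑ k ∈ Finset.Icc 1 (⌊ℓ⌋₊ + 1),
      truncWeight ℓ n * (truncWeight ℓ k * (u n * v k - v n * u k) ^ 2)
      = 2 * (truncInner ℓ u u * truncInner ℓ v v - truncInner ℓ u v ^ 2) := by
  simp only [truncInner, sq, Finset.sum_mul_sum]
  rw [mul_sub, Finset.mul_sum, Finset.mul_sum]
  have hs : ∑ n ∈ Finset.Icc 1 (⌊ℓ⌋₊ + 1), ∑ k ∈ Finset.Icc 1 (⌊ℓ⌋₊ + 1),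
      truncWeight ℓ n * (v n * v n) * (truncWeight ℓ k * (u k * u k))
      = ∑ n ∈ Finset.Icc 1 (⌊ℓ⌋₊ + 1), ∑ k ∈ Finset.Icc 1 (⌊ℓ⌋₊ + 1),
      truncWeight ℓ n * (u n * u n) * (truncWeight ℓ k * (v k * v k)) := by
    rw [Finset.sum_comm]
    exact Finset.sum_congr rfl fun _ _ => Finset.sum_congr rfl fun _ _ => mul_comm _ _
  have hs' : ∑ n ∈ Finset.Icc 1 (⌊ℓ⌋₊ + 1), 2 * ∑ k ∈ Finset.Icc 1 (⌊ℓ⌋₊ + 1),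
      truncWeight ℓ n * (u n * u n) * (truncWeight ℓ k * (v k * v k))
      = ∑ n ∈ Finset.Icc 1 (⌊ℓ⌋₊ + 1), ∑ k ∈ Finset.Icc 1 (⌊ℓ⌋₊ + 1),
      truncWeight ℓ n * (u n * u n) * (truncWeight ℓ k * (v k * v k))
      + ∑ n ∈ Finset.Icc 1 (⌊ℓ⌋₊ + 1), ∑ k ∈ Finset.Icc 1 (⌊ℓ⌋₊ + 1),
      truncWeight ℓ n * (v n * v n) * (truncWeight ℓ k * (u k * u k)) := by
    rw [hs, ← two_mul, Finset.mul_sum]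
  rw [hs', ← Finset.sum_add_distrib, ← Finset.sum_sub_distrib]
  refine Finset.sum_congr rfl fun n _ => ?_
  rw [Finset.mul_sum, ← Finset.sum_add_distrib, ← Finset.sum_sub_distrib]
  exact Finset.sum_congr rfl fun k _ => by ring

theorem truncInner_det_nonneg {ℓ : ℝ} (hℓ : 0 ≤ ℓ) (u v : ℕ → ℝ) :
    0 ≤ truncInner ℓ u u * truncInner ℓ v v - truncInner ℓ u v ^ 2 := by
  have h := truncInner_lagrange ℓ u v
  have : 0 ≤ ∑ n ∈ Finset.Icc 1 (⌊ℓ⌋₊ + 1), ∑ k ∈ Finset.Icc 1 (⌊ℓ⌋₊ + 1),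
      truncWeight ℓ n * (truncWeight ℓ k * (u n * v k - v n * u k) ^ 2) :=
    Finset.sum_nonneg fun n _ => Finset.sum_nonneg fun k _ =>
      mul_nonneg (truncWeight_nonneg hℓ n) (mul_nonneg (truncWeight_nonneg hℓ k) (sq_nonneg _))
  linarith

section Solutions

variable {a b : ℕ → ℝ} {E : ℝ}

theorem jacobiSolution_eq (a b : ℕ → ℝ) (E θ : ℝ) (n : ℕ) :
    jacobiSolution a b E θ n = Real.sin θ * jacobiSolution a b E (Real.pi / 2) n
      + Real.cos θ * jacobiSolution a b E 0 n := by
  induction n using Nat.twoStepInduction with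
  | zero => simp [jacobiSolution]
  | one => simp [jacobiSolution]
  | more n ih1 ih2 =>
    simp only [jacobiSolution]
    rw [ih1, ih2]
    ring

theorem iSup_mul_iInf_truncNorm (a b : ℕ → ℝ) (E : ℝ) {ℓ : ℝ} (hℓ : 0 ≤ ℓ) :
    (⨆ θ : ℝ, truncNorm ℓ (jacobiSolution a b E θ)) *
      (⨅ θ : ℝ, truncNorm ℓ (jacobiSolution a b E θ))
      = √(truncInner ℓ (jacobiSolution a b E 0) (jacobiSolution a b E 0)
          * truncInner ℓ (jacobiSolution a b E (Real.pi / 2)) (jacobiSolution a b E (Real.pi / 2))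
          - truncInner ℓ (jacobiSolution a b E 0) (jacobiSolution a b E (Real.pi / 2)) ^ 2) := by
  have hdet := truncInner_det_nonneg hℓ (jacobiSolution a b E 0) (jacobiSolution a b E (Real.pi / 2))
  refine iSup_mul_iInf_sqrt_form (truncInner_self_nonneg hℓ _) (truncInner_self_nonneg hℓ _)
    (by linarith) _ fun θ => ?_
  rw [truncNorm_eq]
  congr 1
  simp only [truncInner, Finset.sum_mul, Finset.mul_sum, ← Finset.sum_add_distrib]
  refine Finset.sum_congr rfl fun n _ => ?_
  rw [jacobiSolution_eq]
  ring

theorem jacobiSolution_recurrence (ha : ∀ n, a n ≠ 0) (θ : ℝ) (n : ℕ) :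
    a (n + 1) * jacobiSolution a b E θ (n + 2) = (E - b (n + 1)) * jacobiSolution a b E θ (n + 1)
      - a n * jacobiSolution a b E θ n := by
  rw [jacobiSolution]
  field_simp [ha (n + 1)]

/-- The weighted Wronskian is constant in `n`; the initial data and `a 0 = 1` normalize it to `1`.
-/
theorem jacobiSolution_wronskian (ha : ∀ n, a n ≠ 0) (ha0 : a 0 = 1) (n : ℕ) :
    a n * (jacobiSolution a b E 0 (n + 1) * jacobiSolution a b E (Real.pi / 2) n
      - jacobiSolution a b E (Real.pi / 2) (n + 1) * jacobiSolution a b E 0 n) = 1 := by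
  induction n with
  | zero => simp [jacobiSolution, ha0]
  | succ n ih =>
    have h1 := jacobiSolution_recurrence (b := b) (E := E) ha 0 n
    have h2 := jacobiSolution_recurrence (b := b) (E := E) ha (Real.pi / 2) n
    rw [← ih]
    linear_combination jacobiSolution a b E (Real.pi / 2) (n + 1) * h1
      - jacobiSolution a b E 0 (n + 1) * h2

/-- Variation of parameters for a solution `G` of the inhomogeneous energy `z`, with respect to the
solutions at the energy `E`. -/
theorem variation_of_parameters (ha : ∀ n, a n ≠ 0) (ha0 : a 0 = 1) {z : ℂ} {G : ℕ → ℂ}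
    (hG : ∀ n, a (n + 1) * G (n + 2) + a n * G n + b (n + 1) * G (n + 1) = z * G (n + 1)) (n : ℕ) :
    G n = G 0 * jacobiSolution a b E (Real.pi / 2) n + G 1 * jacobiSolution a b E 0 n
      + (z - E) * ∑ k ∈ Finset.Icc 1 n,
        ((jacobiSolution a b E 0 n * jacobiSolution a b E (Real.pi / 2) k
          - jacobiSolution a b E (Real.pi / 2) n * jacobiSolution a b E 0 k : ℝ) : ℂ) * G k := by
  set c : ℕ → ℂ := fun n => jacobiSolution a b E 0 n with hc
  set s : ℕ → ℂ := fun n => jacobiSolution a b E (Real.pi / 2) n with hs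
  have hcr : ∀ n, (a (n + 1) : ℂ) * c (n + 2) = (E - b (n + 1)) * c (n + 1) - a n * c n :=
    fun n => by
      simp only [hc]
      exact_mod_cast congrArg Complex.ofReal (jacobiSolution_recurrence (b := b) (E := E) ha 0 n)
  have hsr : ∀ n, (a (n + 1) : ℂ) * s (n + 2) = (E - b (n + 1)) * s (n + 1) - a n * s n :=
    fun n => by
      simp only [hs]
      exact_mod_cast congrArg Complex.ofReal (jacobiSolution_recurrence (b := b) (E := E) ha (Real.pi / 2) n)
  have hw : ∀ n, (a n : ℂ) * (c (n + 1) * s n - s (n + 1) * c n) = 1 :=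
    fun n => by
      simp only [hc, hs]
      exact_mod_cast congrArg Complex.ofReal (jacobiSolution_wronskian (b := b) (E := E) ha ha0 n)
  let P : ℕ → ℂ := fun n => ∑ k ∈ Finset.Icc 1 n, s k * G k
  let Q : ℕ → ℂ := fun n => ∑ k ∈ Finset.Icc 1 n, c k * G k
  have hP : ∀ n, P (n + 1) = P n + s (n + 1) * G (n + 1) :=
    fun n => Finset.sum_Icc_succ_top (by omega) _
  have hQ : ∀ n, Q (n + 1) = Q n + c (n + 1) * G (n + 1) :=
    fun n => Finset.sum_Icc_succ_top (by omega) _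
  -- The second-order recurrence needs two consecutive values. The sums at `n + 1` may stop at `n`,
  -- because the kernel vanishes on the diagonal.
  have key : ∀ n, G n = G 0 * s n + G 1 * c n + (z - E) * (c n * P n - s n * Q n) ∧
      G (n + 1) = G 0 * s (n + 1) + G 1 * c (n + 1)
        + (z - E) * (c (n + 1) * P n - s (n + 1) * Q n) := by
    intro n
    induction n with
    | zero => simp [P, Q, hc, hs, jacobiSolution]
    | succ n ih =>
      obtain ⟨ih1, ih2⟩ := ih
      refine ⟨?_, ?_⟩
      · rw [hP, hQ]
        linear_combination ih2
      · have hne : (a (n + 1) : ℂ) ≠ 0 := by exact_mod_cast ha (n + 1)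
        refine mul_left_cancel₀ hne ?_
        rw [hP, hQ]
        change (a (n + 1) : ℂ) * G (n + 2) = a (n + 1) * (G 0 * s (n + 2) + G 1 * c (n + 2)
          + (z - E) * (c (n + 2) * (P n + s (n + 1) * G (n + 1))
            - s (n + 2) * (Q n + c (n + 1) * G (n + 1))))
        linear_combination hG n + (E - b (n + 1)) * ih2 - a n * ih1
          - (G 0 + (z - E) * (-(Q n + c (n + 1) * G (n + 1)))) * hsr n
          - (G 1 + (z - E) * (P n + s (n + 1) * G (n + 1))) * hcr n
          - (z - E) * G (n + 1) * hw n
  rw [(key n).1]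
  congr 2
  simp only [P, Q, Finset.mul_sum, ← Finset.sum_sub_distrib]
  refine Finset.sum_congr rfl fun k _ => ?_
  simp only [hc, hs]
  push_cast
  ring

/-- For `k ≤ n ≤ ⌊ℓ⌋ + 1` the weight differs from `1` only at `k = n = ⌊ℓ⌋ + 1`, where the kernel
vanishes. This lets the fractional weight be inserted for free. -/
theorem truncWeight_mul_green (ℓ : ℝ) (u v : ℕ → ℝ) {n k : ℕ} (hn : n ≤ ⌊ℓ⌋₊ + 1) (hk : k ≤ n) :
    u n * v k - v n * u k = truncWeight ℓ k * (u n * v k - v n * u k) := by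
  rcases lt_or_eq_of_le (hk.trans hn) with h | h
  · rw [truncWeight, if_pos (by omega), one_mul]
  · obtain rfl : n = k := by omega
    ring

/-- The Hilbert-Schmidt bound for the Green kernel. -/
theorem green_bound {ℓ : ℝ} (hℓ : 0 ≤ ℓ) (u v : ℕ → ℝ) (G : ℕ → ℂ) :
    ∑ n ∈ Finset.Icc 1 (⌊ℓ⌋₊ + 1), truncWeight ℓ n *
        ‖∑ k ∈ Finset.Icc 1 n, ((u n * v k - v n * u k : ℝ) : ℂ) * G k‖ ^ 2
      ≤ 2 * (truncInner ℓ u u * truncInner ℓ v v - truncInner ℓ u v ^ 2)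
        * ∑ n ∈ Finset.Icc 1 (⌊ℓ⌋₊ + 1), truncWeight ℓ n * ‖G n‖ ^ 2 := by
  -- Each triangular row is bounded by the full row of the square, so that the total is the double
  -- sum in Lagrange's identity.
  rw [← truncInner_lagrange, Finset.sum_mul]
  refine Finset.sum_le_sum fun n hn => ?_
  rw [← Finset.mul_sum, mul_assoc]
  refine mul_le_mul_of_nonneg_left ?_ (truncWeight_nonneg hℓ n)
  have hw : ∀ k, 0 ≤ truncWeight ℓ k := truncWeight_nonneg hℓ
  have hn' := (Finset.mem_Icc.1 hn).2
  calc ‖∑ k ∈ Finset.Icc 1 n, ((u n * v k - v n * u k : ℝ) : ℂ) * G k‖ ^ 2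
      ≤ (∑ k ∈ Finset.Icc 1 (⌊ℓ⌋₊ + 1), (√(truncWeight ℓ k) * |u n * v k - v n * u k|)
          * (√(truncWeight ℓ k) * ‖G k‖)) ^ 2 := by
        gcongr
        refine (norm_sum_le _ _).trans ?_
        calc ∑ k ∈ Finset.Icc 1 n, ‖((u n * v k - v n * u k : ℝ) : ℂ) * G k‖
            ≤ ∑ k ∈ Finset.Icc 1 n, (√(truncWeight ℓ k) * |u n * v k - v n * u k|)
              * (√(truncWeight ℓ k) * ‖G k‖) := by
              refine Finset.sum_le_sum fun k hk => le_of_eq ?_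
              rw [norm_mul, Complex.norm_real, Real.norm_eq_abs,
                truncWeight_mul_green ℓ u v hn' (Finset.mem_Icc.1 hk).2, abs_mul,
                abs_of_nonneg (hw k)]
              have hww : truncWeight ℓ k * |u n * v k - v n * u k| = |u n * v k - v n * u k| := by
                conv_rhs => rw [truncWeight_mul_green ℓ u v hn' (Finset.mem_Icc.1 hk).2, abs_mul,
                  abs_of_nonneg (hw k)]
              rw [hww]
              linear_combination (-‖G k‖ * |u n * v k - v n * u k|) * Real.mul_self_sqrt (hw k)
                - ‖G k‖ * hww
          _ ≤ _ := Finset.sum_le_sum_of_subset_of_nonneg (Finset.Icc_subset_Icc_right hn')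
              fun k _ _ => by positivity
    _ ≤ (∑ k ∈ Finset.Icc 1 (⌊ℓ⌋₊ + 1), (√(truncWeight ℓ k) * |u n * v k - v n * u k|) ^ 2)
        * ∑ k ∈ Finset.Icc 1 (⌊ℓ⌋₊ + 1), (√(truncWeight ℓ k) * ‖G k‖) ^ 2 :=
        Finset.sum_mul_sq_le_sq_mul_sq _ _ _
    _ = _ := by
        congr 1
        · exact Finset.sum_congr rfl fun k _ => by rw [mul_pow, Real.sq_sqrt (hw k), sq_abs]
        · exact Finset.sum_congr rfl fun k _ => by rw [mul_pow, Real.sq_sqrt (hw k)]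

theorem sum_norm_sq_combination {ℓ : ℝ} (u v : ℕ → ℝ) (m : ℂ) :
    ∑ n ∈ Finset.Icc 1 (⌊ℓ⌋₊ + 1), truncWeight ℓ n * ‖-(v n : ℂ) + m * u n‖ ^ 2
      = truncInner ℓ v v - 2 * m.re * truncInner ℓ u v
        + (m.re ^ 2 + m.im ^ 2) * truncInner ℓ u u := by
  simp only [truncInner, Finset.mul_sum, ← Finset.sum_add_distrib, ← Finset.sum_sub_distrib]
  refine Finset.sum_congr rfl fun n _ => ?_
  rw [Complex.sq_norm, Complex.normSq_apply]
  simp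
  ring

/-- If `‖u_θ‖_ℓ` has maximum times minimum equal to `ε⁻¹` at the energy `E`, then the Green
function `G` at a complex energy `z` with `|z - E|² ≤ 2ε²` satisfies
`Im G(1) ≤ 5 ε ‖G‖_ℓ²`. -/
theorem im_le_of_lengthScale (ha : ∀ n, a n ≠ 0) (ha0 : a 0 = 1) {z : ℂ} {G : ℕ → ℂ}
    (hG : ∀ n, a (n + 1) * G (n + 2) + a n * G n + b (n + 1) * G (n + 1) = z * G (n + 1))
    (hG0 : G 0 = -1) {ε ℓ : ℝ} (hε : 0 < ε) (hℓ : 0 ≤ ℓ) (hz : ‖z - E‖ ^ 2 ≤ 2 * ε ^ 2)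
    (hscale : (⨆ θ : ℝ, truncNorm ℓ (jacobiSolution a b E θ)) *
      (⨅ θ : ℝ, truncNorm ℓ (jacobiSolution a b E θ)) = ε⁻¹) :
    (G 1).im ≤ 5 * ε * ∑ n ∈ Finset.Icc 1 (⌊ℓ⌋₊ + 1), truncWeight ℓ n * ‖G n‖ ^ 2 := by
  rw [iSup_mul_iInf_truncNorm a b E hℓ] at hscale
  set u := jacobiSolution a b E 0
  set v := jacobiSolution a b E (Real.pi / 2)
  have hw : ∀ k, 0 ≤ truncWeight ℓ k := truncWeight_nonneg hℓ
  have hD : truncInner ℓ u u * truncInner ℓ v v - truncInner ℓ u v ^ 2 = ε⁻¹ ^ 2 := by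
    rw [← hscale, Real.sq_sqrt (truncInner_det_nonneg hℓ u v)]
  set V : ℕ → ℂ := fun n => ∑ k ∈ Finset.Icc 1 n, ((u n * v k - v n * u k : ℝ) : ℂ) * G k
  set g := ∑ n ∈ Finset.Icc 1 (⌊ℓ⌋₊ + 1), truncWeight ℓ n * ‖G n‖ ^ 2
  have hg : 0 ≤ g := Finset.sum_nonneg fun n _ => mul_nonneg (hw n) (sq_nonneg _)
  have hV : ∑ n ∈ Finset.Icc 1 (⌊ℓ⌋₊ + 1), truncWeight ℓ n * ‖V n‖ ^ 2 ≤ 2 * ε⁻¹ ^ 2 * g := by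
    rw [← hD]
    exact green_bound hℓ u v G
  have hU : ∀ n, -(v n : ℂ) + G 1 * u n = G n - (z - E) * V n := fun n => by
    have := variation_of_parameters (E := E) ha ha0 hG n
    rw [hG0] at this
    linear_combination -this
  have h1 : ∑ n ∈ Finset.Icc 1 (⌊ℓ⌋₊ + 1), truncWeight ℓ n * ‖-(v n : ℂ) + G 1 * u n‖ ^ 2
      ≤ 2 * g + 4 * ε ^ 2 * ∑ n ∈ Finset.Icc 1 (⌊ℓ⌋₊ + 1), truncWeight ℓ n * ‖V n‖ ^ 2 := by
    simp only [g, Finset.mul_sum, ← Finset.sum_add_distrib]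
    refine Finset.sum_le_sum fun n _ => ?_
    have : ‖-(v n : ℂ) + G 1 * u n‖ ^ 2 ≤ 2 * ‖G n‖ ^ 2 + 4 * ε ^ 2 * ‖V n‖ ^ 2 := by
      rw [hU]
      calc ‖G n - (z - E) * V n‖ ^ 2 ≤ (‖G n‖ + ‖(z - E) * V n‖) ^ 2 := by
            gcongr; exact norm_sub_le _ _
        _ ≤ 2 * (‖G n‖ ^ 2 + ‖(z - E) * V n‖ ^ 2) := add_sq_le
        _ = 2 * ‖G n‖ ^ 2 + 2 * ‖z - E‖ ^ 2 * ‖V n‖ ^ 2 := by rw [norm_mul]; ring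
        _ ≤ 2 * ‖G n‖ ^ 2 + 2 * (2 * ε ^ 2) * ‖V n‖ ^ 2 := by gcongr
        _ = _ := by ring
    calc _ ≤ truncWeight ℓ n * (2 * ‖G n‖ ^ 2 + 4 * ε ^ 2 * ‖V n‖ ^ 2) :=
          mul_le_mul_of_nonneg_left this (hw n)
      _ = _ := by ring
  have h2 : 4 * ε ^ 2 * ∑ n ∈ Finset.Icc 1 (⌊ℓ⌋₊ + 1), truncWeight ℓ n * ‖V n‖ ^ 2 ≤ 8 * g := by
    calc _ ≤ 4 * ε ^ 2 * (2 * ε⁻¹ ^ 2 * g) := by gcongr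
      _ = _ := by field_simp; ring
  rw [sum_norm_sq_combination] at h1
  set A := truncInner ℓ u u
  set B := truncInner ℓ v v
  set C := truncInner ℓ u v
  set x := (G 1).re
  set y := (G 1).im
  have hA0 : 0 ≤ A := truncInner_self_nonneg hℓ u
  -- If `A = 0`, the Gram determinant would be nonpositive, while it equals `ε⁻²`.
  have hA : 0 < A := by
    rcases hA0.eq_or_lt with h | h
    · rw [← h, zero_mul] at hD
      have : 0 < ε⁻¹ ^ 2 := by positivity
      nlinarith [sq_nonneg C]
    · exact h
  -- Multiplied by `A`, the right side is `ε⁻² + (C - xA)² + y²A²`, and `ε⁻² + y²A² ≥ 2ε⁻¹yA`.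
  have h3 : 2 * ε⁻¹ * y ≤ B - 2 * x * C + (x ^ 2 + y ^ 2) * A := by
    refine le_of_mul_le_mul_left ?_ hA
    nlinarith [sq_nonneg (C - x * A), sq_nonneg (ε⁻¹ - y * A)]
  -- The `10` is `2` from `‖G‖²` plus `8` from the kernel term.
  have h4 : 2 * ε⁻¹ * y ≤ 10 * g := by linarith
  calc y = ε / 2 * (2 * ε⁻¹ * y) := by field_simp
    _ ≤ ε / 2 * (10 * g) := by gcongr
    _ = _ := by ring

end Solutions

end JacobiSolutions

/-! ### Plancherel's identity for the Fourier integral. -/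

section Plancherel

open scoped FourierTransform ENNReal

theorem ae_eq_of_integral_schwartz_mul_eq {f g : ℝ → ℂ} (hf : LocallyIntegrable f volume)
    (hg : LocallyIntegrable g volume)
    (h : ∀ φ : SchwartzMap ℝ ℂ, ∫ x, φ x • f x = ∫ x, φ x • g x) : f =ᵐ[volume] g := by
  refine ae_eq_of_integral_contDiff_smul_eq hf hg fun p hp hps => ?_
  have h1 : ContDiff ℝ (⊤ : ℕ∞) fun x => (p x : ℂ) := Complex.ofRealCLM.contDiff.comp hp
  have h2 : HasCompactSupport fun x => (p x : ℂ) := 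
    hps.comp_left (g := fun r : ℝ => (r : ℂ)) Complex.ofReal_zero
  have h3 := h (h2.toSchwartzMap h1)
  have h4 : ∀ x (w : ℂ), (h2.toSchwartzMap h1) x • w = p x • w := fun x w => Complex.coe_smul _ _
  simpa only [h4] using h3

/-- The multiplication formula (Fubini) moves the transform onto the test function. It identifies
the Fourier integral with the distributional transform, hence with the `L²` transform. -/
theorem integral_schwartz_mul_fourier {f : ℝ → ℂ} (hf : Integrable f) (φ : SchwartzMap ℝ ℂ) :
    ∫ x, (𝓕 φ) x • f x = ∫ x, φ x • 𝓕 f x := by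
  have h := VectorFourier.integral_fourierIntegral_smul_eq_flip (μ := volume) (ν := volume)
    (L := innerₗ ℝ) Real.continuous_fourierChar (by fun_prop) φ.integrable hf
  rw [flip_innerₗ] at h
  exact h

/-- On `L¹ ∩ L²`, the Fourier integral agrees with the Fourier transform on `L²`. -/
theorem fourier_toLp_ae_eq {f : ℝ → ℂ} (hf1 : Integrable f) (hf2 : MemLp f 2) :
    (𝓕 (hf2.toLp f) : Lp ℂ 2 (volume : Measure ℝ)) =ᵐ[volume] 𝓕 f := by
  have hc : Continuous (𝓕 f) :=
    VectorFourier.fourierIntegral_continuous Real.continuous_fourierChar (by fun_prop) hf1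
  have hF := Lp.fourier_toTemperedDistribution_eq (hf2.toLp f)
  refine ae_eq_of_integral_schwartz_mul_eq ((Lp.memLp _).locallyIntegrable (by norm_num))
    hc.locallyIntegrable fun φ => ?_
  have h1 := congrArg (fun ψ => ψ φ) hF
  simp only [TemperedDistribution.fourier_apply, Lp.toTemperedDistribution_apply] at h1
  rw [← h1, ← integral_schwartz_mul_fourier hf1]
  exact integral_congr_ae (by filter_upwards [hf2.coeFn_toLp] with x hx; rw [hx])

/-- Plancherel's identity on `L¹ ∩ L²`. -/
theorem lintegral_fourier_sq {f : ℝ → ℂ} (hf1 : Integrable f) (hf2 : MemLp f 2) :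
    ∫⁻ x, ‖𝓕 f x‖ₑ ^ 2 = ∫⁻ x, ‖f x‖ₑ ^ 2 := by
  have h := congrArg (fun r : ℝ => ENNReal.ofReal r) (Lp.norm_fourier_eq (hf2.toLp f))
  simp only [ofReal_norm, Lp.enorm_def] at h
  rw [eLpNorm_congr_ae (fourier_toLp_ae_eq hf1 hf2), eLpNorm_congr_ae hf2.coeFn_toLp] at h
  simp only [eLpNorm_eq_lintegral_rpow_enorm_toReal (p := 2) two_ne_zero ENNReal.ofNat_ne_top] at h
  simpa using ENNReal.rpow_left_injective (by norm_num) h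

end Plancherel

section SelfAdjointness

/-! ### Self-adjointness of `Δ + V` -/

/-- Since `⟨g, Tg⟩` is real, the imaginary part of `⟨g, (T - z)g⟩` is `-Im z ‖g‖²`; then
Cauchy-Schwarz. -/
theorem im_mul_norm_le_of_isSymmetric {W : Type*} [NormedAddCommGroup W] [InnerProductSpace ℂ W]
    {T : W →ₗ[ℂ] W} (hT : T.IsSymmetric) (z : ℂ) (g : W) : |z.im| * ‖g‖ ≤ ‖T g - z • g‖ := by
  rcases eq_or_ne g 0 with rfl | hg
  · simp
  have hpos : 0 < ‖g‖ := norm_pos_iff.2 hg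
  have h1 : (inner ℂ g (T g - z • g)).im = -(z.im * ‖g‖ ^ 2) := by
    have h2 : (inner ℂ g (T g)).im = 0 := by
      have := hT.im_inner_self_apply g
      simpa using this
    rw [inner_sub_right, inner_smul_right, inner_self_eq_norm_sq_to_K, Complex.sub_im, h2,
      Complex.mul_im]
    simp only [← Complex.ofReal_pow, Complex.coe_algebraMap, Complex.ofReal_re, Complex.ofReal_im]
    ring
  have h3 : |z.im| * ‖g‖ ^ 2 ≤ ‖g‖ * ‖T g - z • g‖ := by
    calc |z.im| * ‖g‖ ^ 2 = |(inner ℂ g (T g - z • g)).im| := by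
          rw [h1, abs_neg, abs_mul, abs_of_nonneg (sq_nonneg ‖g‖)]
      _ ≤ ‖inner ℂ g (T g - z • g)‖ := Complex.abs_im_le_norm _
      _ ≤ _ := norm_inner_le_norm _ _
  refine le_of_mul_le_mul_left ?_ hpos
  linarith

theorem exists_finite_resolvent {W : Type*} [NormedAddCommGroup W] [InnerProductSpace ℂ W]
    [FiniteDimensional ℂ W] {T : W →ₗ[ℂ] W} (hT : T.IsSymmetric) {z : ℂ} (hz : z.im ≠ 0) (ψ : W) :
    ∃ g : W, T g - z • g = ψ := by
  have hinj : Function.Injective (T - z • (LinearMap.id : W →ₗ[ℂ] W)) := by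
    rw [injective_iff_map_eq_zero]
    intro g hg
    have h1 := im_mul_norm_le_of_isSymmetric hT z g
    have h2 : T g - z • g = 0 := hg
    rw [h2, norm_zero] at h1
    have h3 : 0 < |z.im| := abs_pos.2 hz
    exact norm_le_zero_iff.1 (nonpos_of_mul_nonpos_right h1 h3)
  obtain ⟨g, hg⟩ := LinearMap.injective_iff_surjective.1 hinj ψ
  exact ⟨g, hg⟩

theorem boxMatrix_isSymmetric {d : ℕ} (V : (Fin d → ℤ) → ℝ) (F : Finset (Fin d → ℤ)) :
    (Matrix.toEuclideanLin (boxMatrix V F)).IsSymmetric :=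
  Matrix.isSymmetric_toEuclideanLin_iff.2 (boxMatrix_isHermitian V F)

theorem boxMatrix_apply_restr {d : ℕ} (V : (Fin d → ℤ) → ℝ) {F : Finset (Fin d → ℤ)}
    {h : (Fin d → ℤ) → ℂ} (n : F) (hF : neighbors n.1 ⊆ F) :
    Matrix.toEuclideanLin (boxMatrix V F) (restr F h) n = action V h n := by
  classical
  have h1 : Matrix.toEuclideanLin (boxMatrix V F) (restr F h) n
      = ∑ m : F, boxMatrix V F n m * h m := rfl
  have h2 : action V h n = ∑ m ∈ neighbors n.1, h m + (V n : ℂ) * h n := rfl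
  rw [h1, h2]
  simp only [boxMatrix, add_mul, Finset.sum_add_distrib, ite_mul, one_mul, zero_mul]
  congr 1
  · rw [Finset.sum_coe_sort F fun m => if m ∈ neighbors n.1 then h m else 0, ← Finset.sum_filter,
      Finset.filter_mem_eq_inter, Finset.inter_eq_right.2 hF]
  · simp

/-- The resolvent of `Δ + V` exists at every non-real energy. -/
theorem exists_resolvent {d : ℕ} (V : (Fin d → ℤ) → ℝ) {z : ℂ} (hz : z.im ≠ 0) (ψ : L2 d) :
    ∃ g : (hamiltonian V).domain, hamiltonian V g - z • (g : L2 d) = ψ := by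
  classical
  have hpos : 0 < |z.im| := abs_pos.2 hz
  -- The resolvents of the finite boxes obey `‖u F‖ ≤ ‖ψ‖ / |Im z|` uniformly in the box, however
  -- large `V` is.
  choose u hu using fun F => exists_finite_resolvent (boxMatrix_isSymmetric V F) hz (restr F ψ)
  set K := ‖ψ‖ / |z.im|
  have hK : 0 ≤ K := by positivity
  have huK : ∀ F, ‖u F‖ ≤ K := fun F => by
    rw [le_div_iff₀ hpos, mul_comm]
    refine (im_mul_norm_le_of_isSymmetric (boxMatrix_isSymmetric V F) z (u F)).trans ?_
    rw [hu F]
    exact norm_restr_le F ψ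
  let h : Finset (Fin d → ℤ) → (Fin d → ℤ) → ℂ := fun F n => if hn : n ∈ F then u F ⟨n, hn⟩ else 0
  have hrestr : ∀ F, restr F (h F) = u F := fun F => by
    ext n
    simp [restr, h]
  have hsum : ∀ F (s : Finset (Fin d → ℤ)), ∑ n ∈ s, ‖h F n‖ ^ 2 ≤ K ^ 2 := fun F s => by
    calc ∑ n ∈ s, ‖h F n‖ ^ 2 = ∑ n ∈ s ∩ F, ‖h F n‖ ^ 2 := by
          refine (Finset.sum_subset Finset.inter_subset_left fun n hn hn' => ?_).symm
          have : n ∉ F := fun h => hn' (Finset.mem_inter.2 ⟨hn, h⟩)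
          simp [h, this]
      _ ≤ ∑ n ∈ F, ‖h F n‖ ^ 2 := Finset.sum_le_sum_of_subset_of_nonneg Finset.inter_subset_right
          fun _ _ _ => by positivity
      _ = ‖u F‖ ^ 2 := by rw [← norm_restr_sq, hrestr]
      _ ≤ K ^ 2 := by gcongr; exact huK F
  have hpt : ∀ F n, ‖h F n‖ ≤ K := fun F n => by
    have := hsum F {n}
    rw [Finset.sum_singleton] at this
    exact (sq_le_sq₀ (norm_nonneg _) hK).1 this
  let 𝒰 : Ultrafilter (Finset (Fin d → ℤ)) := Ultrafilter.of atTop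
  have h𝒰 : (𝒰 : Filter (Finset (Fin d → ℤ))) ≤ atTop := Ultrafilter.of_le _
  -- A pointwise limit exists by Tychonoff for a product of discs; bounds on finite partial sums
  -- then put it in `ℓ²`.
  obtain ⟨g, -, hg⟩ := (isCompact_univ_pi fun _ : Fin d → ℤ =>
    isCompact_closedBall (0 : ℂ) K).ultrafilter_le_nhds (𝒰.map h) (by
      rw [Ultrafilter.coe_map, le_principal_iff, Filter.mem_map]
      refine Filter.univ_mem' fun F n _ => ?_
      simpa using hpt F n)
  have hlim : ∀ n, Tendsto (fun F => h F n) 𝒰 (𝓝 (g n)) := tendsto_pi_nhds.1 hg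
  have hg2 : Memℓp g 2 := memℓp_gen' (C := K ^ 2) fun s => by
    have h1 : Tendsto (fun F => ∑ n ∈ s, ‖h F n‖ ^ 2) 𝒰 (𝓝 (∑ n ∈ s, ‖g n‖ ^ 2)) :=
      tendsto_finsetSum _ fun n _ => (hlim n).norm.pow 2
    have h2 := le_of_tendsto' h1 fun F => hsum F s
    simpa using h2
  have heq : ∀ n, action V g n = z * g n + ψ n := fun n => by
    have h1 : Tendsto (fun F => action V (h F) n) 𝒰 (𝓝 (action V g n)) :=
      (tendsto_finsetSum _ fun m _ => hlim m).add ((hlim n).const_mul _)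
    have h2 : Tendsto (fun F => z * h F n + ψ n) 𝒰 (𝓝 (z * g n + ψ n)) :=
      ((hlim n).const_mul _).add_const _
    refine tendsto_nhds_unique_of_eventuallyEq h1 h2 (h𝒰 ?_)
    -- `H` has finite range, so the equation at `n` holds exactly once the box contains `n` and its
    -- neighbors.
    filter_upwards [eventually_ge_atTop (insert n (neighbors n))] with F hF
    have hn : n ∈ F := hF (Finset.mem_insert_self _ _)
    have hN : neighbors n ⊆ F := (Finset.subset_insert _ _).trans hF
    have h3 := congrArg (fun w : EuclideanSpace ℂ F => w ⟨n, hn⟩) (hu F)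
    rw [← hrestr F] at h3
    have h4 : Matrix.toEuclideanLin (boxMatrix V F) (restr F (h F)) ⟨n, hn⟩ - z * h F n = ψ n := h3
    rw [boxMatrix_apply_restr V ⟨n, hn⟩ hN] at h4
    change action V (h F) n = _
    rw [← h4]
    ring
  have hmem : Memℓp (action V g) 2 := by
    have : action V g = z • g + (ψ : (Fin d → ℤ) → ℂ) := funext heq
    rw [this]
    exact (hg2.const_smul z).add (lp.memℓp ψ)
  refine ⟨⟨⟨g, hg2⟩, hmem⟩, lp.ext (funext fun n => ?_)⟩
  change action V g n - z * g n = ψ n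
  rw [heq]
  ring

/-- The box matrices are symmetric. They differ from the restricted operator only by hopping terms
across the boundary, since `V` cancels exactly, and by `boxMatrix_error` these tend to zero in norm.
-/
theorem hamiltonian_symmetric {d : ℕ} (V : (Fin d → ℤ) → ℝ) (φ g : (hamiltonian V).domain) :
    inner ℂ (hamiltonian V φ) (g : L2 d) = inner ℂ (φ : L2 d) (hamiltonian V g) := by
  let T := fun F : Finset (Fin d → ℤ) => Matrix.toEuclideanLin (boxMatrix V F)
  have hb : ∀ f : (hamiltonian V).domain,
      Tendsto (fun F => ‖T F (restr F (f : L2 d)) - restr F (hamiltonian V f)‖) atTop (𝓝 0) := by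
    intro f
    have hnorm : Tendsto (fun F => ‖restr F (f : L2 d)‖ ^ 2) atTop (𝓝 (‖(f : L2 d)‖ ^ 2)) := by
      have h : HasSum _ _ := hasSum_norm_sq (f : L2 d)
      exact Tendsto.congr (fun F => (norm_restr_sq F _).symm) h
    have h1 := ((hnorm.const_sub (‖(f : L2 d)‖ ^ 2)).const_mul ((3 ^ d : ℝ) ^ 2)).sqrt
    rw [sub_self, mul_zero, Real.sqrt_zero] at h1
    exact squeeze_zero (fun _ => norm_nonneg _)
      (fun F => Real.le_sqrt_of_sq_le (boxMatrix_error V F f)) h1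
  have hlim := (tendsto_inner_restr (hamiltonian V φ) (g : L2 d)).sub
    (tendsto_inner_restr (φ : L2 d) (hamiltonian V g))
  have hbound : Tendsto (fun F => ‖T F (restr F (φ : L2 d)) - restr F (hamiltonian V φ)‖ * ‖(g : L2 d)‖
      + ‖(φ : L2 d)‖ * ‖T F (restr F (g : L2 d)) - restr F (hamiltonian V g)‖) atTop (𝓝 0) := by
    simpa using ((hb φ).mul_const ‖(g : L2 d)‖).add ((hb g).const_mul ‖(φ : L2 d)‖)
  refine sub_eq_zero.1 (tendsto_nhds_unique hlim (squeeze_zero_norm (fun F => ?_) hbound))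
  have hs : inner ℂ (T F (restr F (φ : L2 d))) (restr F (g : L2 d))
      = inner ℂ (restr F (φ : L2 d)) (T F (restr F (g : L2 d))) := boxMatrix_isSymmetric V F _ _
  have heq : inner ℂ (restr F (hamiltonian V φ)) (restr F (g : L2 d))
      - inner ℂ (restr F (φ : L2 d)) (restr F (hamiltonian V g))
      = -inner ℂ (T F (restr F (φ : L2 d)) - restr F (hamiltonian V φ)) (restr F (g : L2 d))
      + inner ℂ (restr F (φ : L2 d)) (T F (restr F (g : L2 d)) - restr F (hamiltonian V g)) := by
    rw [inner_sub_left, inner_sub_right, hs]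
    ring
  rw [heq]
  refine (norm_add_le _ _).trans ?_
  rw [norm_neg]
  refine add_le_add ((norm_inner_le_norm _ _).trans ?_) ((norm_inner_le_norm _ _).trans ?_)
  · gcongr
    exact norm_restr_le F g
  · gcongr
    exact norm_restr_le F φ

end SelfAdjointness

section OrthonormalPolynomials

/-! ### The orthonormal polynomial representation -/

open InnerProductSpace

variable {d : ℕ} (V : (Fin d → ℤ) → ℝ)

theorem siteNorm_le_add_of_mem_neighbors {n m : Fin d → ℤ} (h : m ∈ neighbors n) :
    siteNorm n ≤ siteNorm m + 1 := by
  rw [← mem_neighbors.1 h, siteNorm, siteNorm, siteNorm, ← Finset.sum_add_distrib]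
  refine Finset.sum_le_sum fun i _ => ?_
  have := abs_add_le (m i) (n i - m i)
  simpa using this

theorem moment_succ (k : ℕ) : (moment V (k + 1) : (Fin d → ℤ) → ℂ) = action V (moment V k) :=
  Function.iterate_succ_apply' _ _ _

theorem moment_apply_eq_zero (k : ℕ) {n : Fin d → ℤ} (hn : k < siteNorm n) : moment V k n = 0 := by
  induction k generalizing n with
  | zero =>
    refine Pi.single_eq_of_ne (M := fun _ => ℂ) ?_ 1
    rintro rfl
    simp [siteNorm] at hn
  | succ k ih =>
    rw [moment_succ]
    change ∑ m ∈ neighbors n, moment V k m + (V n : ℂ) * moment V k n = 0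
    push_cast at hn
    rw [ih (by omega), mul_zero, add_zero]
    exact Finset.sum_eq_zero fun m hm => ih (by
      have := siteNorm_le_add_of_mem_neighbors hm
      omega)

/-- The site at distance `k` on the first coordinate axis. -/
def axis (hd : 0 < d) (k : ℕ) : Fin d → ℤ := Pi.single ⟨0, hd⟩ (k : ℤ)

theorem siteNorm_axis (hd : 0 < d) (k : ℕ) : siteNorm (axis hd k) = k := by
  rw [siteNorm, Finset.sum_eq_single_of_mem ⟨0, hd⟩ (Finset.mem_univ _)]
  · simp [axis]
  · intro i _ hi
    simp [axis, Pi.single_eq_of_ne hi]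

theorem axis_mem_neighbors (hd : 0 < d) (k : ℕ) : axis hd k ∈ neighbors (axis hd (k + 1)) := by
  rw [mem_neighbors, axis, axis, ← Pi.single_sub]
  have := siteNorm_axis hd 1
  rw [axis] at this
  simpa using this

theorem eq_axis_of_mem_neighbors (hd : 0 < d) {k : ℕ} {m : Fin d → ℤ}
    (hm : m ∈ neighbors (axis hd (k + 1))) (hk : siteNorm m ≤ k) : m = axis hd k := by
  have h1 := mem_neighbors.1 hm
  have hs : ∀ n : Fin d → ℤ, siteNorm n
      = |n ⟨0, hd⟩| + ∑ i ∈ Finset.univ.erase (⟨0, hd⟩ : Fin d), |n i| := fun n =>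
    (Finset.add_sum_erase _ _ (Finset.mem_univ _)).symm
  have h2 : ∑ i ∈ Finset.univ.erase (⟨0, hd⟩ : Fin d), |(axis hd (k + 1) - m) i|
      = ∑ i ∈ Finset.univ.erase (⟨0, hd⟩ : Fin d), |m i| :=
    Finset.sum_congr rfl fun i hi => by
      simp [axis, Pi.single_eq_of_ne (Finset.ne_of_mem_erase hi)]
  have h3 : 0 ≤ ∑ i ∈ Finset.univ.erase (⟨0, hd⟩ : Fin d), |m i| :=
    Finset.sum_nonneg fun _ _ => abs_nonneg _
  rw [hs, h2] at h1
  rw [hs] at hk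
  simp only [Pi.sub_apply, axis, Pi.single_eq_same] at h1
  push_cast at h1
  have h4 : m ⟨0, hd⟩ = k ∧ ∑ i ∈ Finset.univ.erase (⟨0, hd⟩ : Fin d), |m i| = 0 := by
    generalize ∑ i ∈ Finset.univ.erase (⟨0, hd⟩ : Fin d), |m i| = S at *
    rcases abs_cases (m ⟨0, hd⟩) with h | h <;>
    rcases abs_cases ((k : ℤ) + 1 - m ⟨0, hd⟩) with h' | h' <;> omega
  have h5 := (Finset.sum_eq_zero_iff_of_nonneg fun _ _ => abs_nonneg _).1 h4.2
  funext i
  by_cases hi : i = ⟨0, hd⟩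
  · subst hi
    simp [axis, h4.1]
  · have := h5 i (Finset.mem_erase.2 ⟨hi, Finset.mem_univ _⟩)
    rw [axis, Pi.single_eq_of_ne hi]
    exact abs_eq_zero.1 this

/-- Only one nearest-neighbor path of length `k` joins `0` to the site at distance `k` on the axis,
and the potential needs an extra step to contribute. With the support bound, this makes the moments
linearly independent. -/
theorem moment_apply_axis (hd : 0 < d) (k : ℕ) : moment V k (axis hd k) = 1 := by
  induction k with
  | zero =>
    have : axis hd 0 = 0 := by simp [axis]
    rw [this]
    exact Pi.single_eq_same (M := fun _ => ℂ) 0 1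
  | succ k ih =>
    rw [moment_succ]
    change ∑ m ∈ neighbors (axis hd (k + 1)), moment V k m
      + (V (axis hd (k + 1)) : ℂ) * moment V k (axis hd (k + 1)) = 1
    rw [moment_apply_eq_zero V k (by rw [siteNorm_axis]; push_cast; omega), mul_zero, add_zero,
      Finset.sum_eq_single_of_mem _ (axis_mem_neighbors hd k), ih]
    intro m hm hne
    refine moment_apply_eq_zero V k ?_
    by_contra h
    exact hne (eq_axis_of_mem_neighbors hd hm (not_lt.1 h))

theorem apply_eq_zero_of_mem_span_moment {k : ℕ} {v : L2 d}
    (hv : v ∈ Submodule.span ℂ (moment V '' Set.Iic k)) {n : Fin d → ℤ} (hn : k < siteNorm n) :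
    v n = 0 := by
  induction hv using Submodule.span_induction with
  | mem x hx =>
    obtain ⟨j, hj, rfl⟩ := hx
    have : (j : ℤ) ≤ k := by exact_mod_cast hj
    exact moment_apply_eq_zero V j (by omega)
  | zero => rfl
  | add x y _ _ hx hy =>
    rw [lp.coeFn_add, Pi.add_apply, hx, hy, add_zero]
  | smul c x _ hx =>
    rw [lp.coeFn_smul, Pi.smul_apply, hx, smul_zero]

theorem moment_notMem_span (hd : 0 < d) (k : ℕ) :
    moment V k ∉ Submodule.span ℂ (moment V '' Set.Iio k) := by
  intro h
  rcases k with _ | k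
  · simp only [Set.Iio_zero_eq_empty, Set.image_empty, Submodule.span_empty,
      Submodule.mem_bot] at h
    have := moment_apply_axis V hd 0
    rw [h] at this
    simp at this
  · have h2 : Set.Iio (k + 1) = Set.Iic k := by ext; simp
    rw [h2] at h
    have h1 := moment_apply_axis V hd (k + 1)
    rw [apply_eq_zero_of_mem_span_moment V h (by rw [siteNorm_axis]; push_cast; omega)] at h1
    exact zero_ne_one h1

/-- The Gram-Schmidt orthogonalization of the moment vectors, before normalization. -/
def gs (k : ℕ) : L2 d := gramSchmidt ℂ (moment V) k

theorem gs_mem_span (k : ℕ) : gs V k ∈ Submodule.span ℂ (moment V '' Set.Iic k) :=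
  gramSchmidt_mem_span ℂ (moment V) le_rfl

theorem moment_sub_gs_mem_span (k : ℕ) :
    moment V k - gs V k ∈ Submodule.span ℂ (moment V '' Set.Iio k) := by
  rw [← span_gramSchmidt_Iio ℂ (moment V) k, gs,
    sub_eq_of_eq_add' (gramSchmidt_def' ℂ (moment V) k)]
  refine Submodule.sum_mem _ fun i hi => ?_
  rw [Submodule.starProjection_singleton]
  exact Submodule.smul_mem _ _ (Submodule.subset_span ⟨i, by simpa using hi, rfl⟩)

theorem gs_ne_zero (hd : 0 < d) (k : ℕ) : gs V k ≠ 0 := by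
  intro h
  have := moment_sub_gs_mem_span V k
  rw [h, sub_zero] at this
  exact moment_notMem_span V hd k this

theorem rho_eq (k : ℕ) : rho V k = ((‖gs V k‖⁻¹ : ℝ) : ℂ) • gs V k := by
  rw [rho, gramSchmidtNormed, gs]
  push_cast
  rfl

theorem rho_mem_span (k : ℕ) : rho V k ∈ Submodule.span ℂ (moment V '' Set.Iic k) := by
  rw [rho_eq]
  exact Submodule.smul_mem _ _ (gs_mem_span V k)

theorem rho_apply_eq_zero (k : ℕ) {n : Fin d → ℤ} (hn : k < siteNorm n) : rho V k n = 0 :=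
  apply_eq_zero_of_mem_span_moment V (rho_mem_span V k) hn

theorem rho_orthonormal (hd : 0 < d) : Orthonormal ℂ (rho V) := by
  refine ⟨fun k => ?_, fun i j hij => ?_⟩
  · have h : ‖gs V k‖ ≠ 0 := norm_ne_zero_iff.2 (gs_ne_zero V hd k)
    rw [rho_eq, norm_smul, Complex.norm_real, norm_inv, norm_norm, inv_mul_cancel₀ h]
  · change inner ℂ (rho V i) (rho V j) = 0
    rw [rho_eq, rho_eq, inner_smul_left, inner_smul_right]
    simp [gs, gramSchmidt_orthogonal ℂ (moment V) hij]

theorem inner_gs_eq_zero {k : ℕ} {v : L2 d}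
    (hv : v ∈ Submodule.span ℂ (moment V '' Set.Iio k)) : inner ℂ (gs V k) v = 0 := by
  induction hv using Submodule.span_induction with
  | mem x hx =>
    obtain ⟨j, hj, rfl⟩ := hx
    exact gramSchmidt_inv_triangular ℂ (moment V) hj
  | zero => exact inner_zero_right _
  | add x y _ _ hx hy => rw [inner_add_right, hx, hy, add_zero]
  | smul c x _ hx => rw [inner_smul_right, hx, mul_zero]

theorem inner_rho_eq_zero {k : ℕ} {v : L2 d}
    (hv : v ∈ Submodule.span ℂ (moment V '' Set.Iio k)) : inner ℂ (rho V k) v = 0 := by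
  rw [rho_eq, inner_smul_left, inner_gs_eq_zero V hv, mul_zero]

theorem span_rho_Iic (k : ℕ) : Submodule.span ℂ (rho V '' Set.Iic k)
    = Submodule.span ℂ (moment V '' Set.Iic k) := by
  rw [← span_gramSchmidt_Iic ℂ (moment V) k]
  exact span_gramSchmidtNormed (moment V) _

/-- `H` maps the span of the moments `H^jδ_0`, `j ∈ s`, to the span of the moments `H^{j+1}δ_0`. -/
theorem hamiltonian_mem_span {s : Set ℕ} {v : (hamiltonian V).domain}
    (hv : (v : L2 d) ∈ Submodule.span ℂ (moment V '' s)) :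
    hamiltonian V v ∈ Submodule.span ℂ (moment V '' ((· + 1) '' s)) := by
  have key : ∀ u ∈ Submodule.span ℂ (moment V '' s),
      ∃ w ∈ Submodule.span ℂ (moment V '' ((· + 1) '' s)),
        (w : (Fin d → ℤ) → ℂ) = action V u := by
    intro u hu
    induction hu using Submodule.span_induction with
    | mem x hx =>
      obtain ⟨j, hj, rfl⟩ := hx
      exact ⟨moment V (j + 1), Submodule.subset_span ⟨j + 1, ⟨j, hj, rfl⟩, rfl⟩, moment_succ V j⟩
    | zero => exact ⟨0, Submodule.zero_mem _, by rw [lp.coeFn_zero, map_zero]⟩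
    | add x y _ _ hx hy =>
      obtain ⟨p, hp, hp'⟩ := hx
      obtain ⟨q, hq, hq'⟩ := hy
      exact ⟨p + q, Submodule.add_mem _ hp hq, by rw [lp.coeFn_add, hp', hq', lp.coeFn_add, map_add]⟩
    | smul c x _ hx =>
      obtain ⟨p, hp, hp'⟩ := hx
      exact ⟨c • p, Submodule.smul_mem _ _ hp, by rw [lp.coeFn_smul, hp', lp.coeFn_smul, map_smul]⟩
  obtain ⟨w, hw, hw'⟩ := key v hv
  have : hamiltonian V v = w := lp.ext hw'.symm
  rwa [this]

/-- The vector `Hρ_k`. -/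
def hamRho (k : ℕ) : L2 d := hamiltonian V ⟨rho V k, rho_mem_domain V k⟩

theorem hamRho_mem_span (k : ℕ) :
    hamRho V k ∈ Submodule.span ℂ (moment V '' Set.Iic (k + 1)) := by
  refine Submodule.span_mono (Set.image_mono ?_)
    (hamiltonian_mem_span V (v := ⟨rho V k, rho_mem_domain V k⟩) (rho_mem_span V k))
  rintro _ ⟨j, hj, rfl⟩
  exact Nat.succ_le_succ hj

theorem inner_hamRho_left (j k : ℕ) : inner ℂ (hamRho V j) (rho V k)
    = inner ℂ (rho V j) (hamRho V k) :=
  hamiltonian_symmetric V ⟨rho V j, rho_mem_domain V j⟩ ⟨rho V k, rho_mem_domain V k⟩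

theorem inner_rho_hamRho_eq_zero {j k : ℕ} (h : k + 1 < j) : inner ℂ (rho V j) (hamRho V k) = 0 :=
  inner_rho_eq_zero V (Submodule.span_mono (Set.image_mono fun i hi => by
    have : i ≤ k + 1 := hi
    exact lt_of_le_of_lt this h) (hamRho_mem_span V k))

/-- Modulo `H` applied to lower moments, `H` of the `k`-th orthogonalized vector is the moment of
order `k + 1`; the discarded part is orthogonal to `gs V (k + 1)`. Hence `a(k + 1)` is the positive
number `‖gs V (k + 1)‖ / ‖gs V k‖`. -/
theorem inner_gs_succ_hamRho (k : ℕ) :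
    inner ℂ (gs V (k + 1)) (hamRho V k) = ((‖gs V k‖⁻¹ * ‖gs V (k + 1)‖ ^ 2 : ℝ) : ℂ) := by
  have hdom : ∀ j, moment V j ∈ (hamiltonian V).domain := fun j =>
    mem_domain_of_finite V (iterate_support_finite V j)
  let m : (hamiltonian V).domain := ⟨moment V k, hdom k⟩
  let r : (hamiltonian V).domain := ⟨rho V k, rho_mem_domain V k⟩
  have hgs : gs V k ∈ (hamiltonian V).domain := by
    refine Submodule.span_le.2 ?_ (gs_mem_span V k)
    rintro _ ⟨j, -, rfl⟩
    exact hdom j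
  let g : (hamiltonian V).domain := ⟨gs V k, hgs⟩
  have h1 : hamRho V k = ((‖gs V k‖⁻¹ : ℝ) : ℂ) • hamiltonian V g := by
    have : r = ((‖gs V k‖⁻¹ : ℝ) : ℂ) • g := Subtype.ext (rho_eq V k)
    change hamiltonian V r = _
    rw [this, LinearPMap.map_smul]
  have h2 : hamiltonian V g = hamiltonian V m - hamiltonian V (m - g) := by
    rw [LinearPMap.map_sub]
    abel
  have h3 : hamiltonian V m = moment V (k + 1) := lp.ext (moment_succ V k).symm
  have h4 : inner ℂ (gs V (k + 1)) (hamiltonian V (m - g)) = 0 := by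
    refine inner_gs_eq_zero V (Submodule.span_mono (Set.image_mono ?_)
      (hamiltonian_mem_span V (v := m - g) (moment_sub_gs_mem_span V k)))
    rintro _ ⟨j, hj, rfl⟩
    exact Nat.succ_lt_succ hj
  have h5 : inner ℂ (gs V (k + 1)) (moment V (k + 1)) = ((‖gs V (k + 1)‖ ^ 2 : ℝ) : ℂ) := by
    have h6 := inner_gs_eq_zero V (moment_sub_gs_mem_span V (k + 1))
    rw [inner_sub_right, sub_eq_zero] at h6
    rw [h6, inner_self_eq_norm_sq_to_K]
    push_cast
    rfl
  rw [h1, inner_smul_right, h2, h3, inner_sub_right, h4, sub_zero, h5]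
  push_cast
  rfl

theorem inner_rho_succ_hamRho (k : ℕ) : inner ℂ (rho V (k + 1)) (hamRho V k)
    = ((‖gs V (k + 1)‖⁻¹ * (‖gs V k‖⁻¹ * ‖gs V (k + 1)‖ ^ 2) : ℝ) : ℂ) := by
  rw [rho_eq, inner_smul_left, inner_gs_succ_hamRho, Complex.conj_ofReal]
  push_cast
  rfl

theorem inner_rho_succ_hamRho_eq_polyA (k : ℕ) :
    inner ℂ (rho V (k + 1)) (hamRho V k) = (polyA V (k + 1) : ℂ) := by
  change _ = (((inner ℂ (rho V (k + 1)) (hamRho V k) : ℂ).re : ℝ) : ℂ)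
  rw [inner_rho_succ_hamRho, Complex.ofReal_re]

theorem inner_rho_hamRho_self_eq_polyB (k : ℕ) :
    inner ℂ (rho V k) (hamRho V k) = (polyB V (k + 1) : ℂ) := by
  change _ = (((inner ℂ (rho V k) (hamRho V k) : ℂ).re : ℝ) : ℂ)
  rw [eq_comm, ← Complex.conj_eq_iff_re, inner_conj_symm, inner_hamRho_left]

theorem inner_rho_hamRho_succ_eq_polyA (k : ℕ) :
    inner ℂ (rho V k) (hamRho V (k + 1)) = (polyA V (k + 1) : ℂ) := by
  rw [← inner_hamRho_left, ← inner_conj_symm, inner_rho_succ_hamRho_eq_polyA, Complex.conj_ofReal]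

theorem polyA_ne_zero (hd : 0 < d) (k : ℕ) : polyA V k ≠ 0 := by
  rcases k with _ | k
  · exact one_ne_zero
  · have h := inner_rho_succ_hamRho_eq_polyA V k
    rw [inner_rho_succ_hamRho] at h
    rw [← Complex.ofReal_inj.1 h]
    have h1 : ‖gs V k‖ ≠ 0 := norm_ne_zero_iff.2 (gs_ne_zero V hd k)
    have h2 : ‖gs V (k + 1)‖ ≠ 0 := norm_ne_zero_iff.2 (gs_ne_zero V hd (k + 1))
    positivity

theorem eq_zero_of_forall_inner_rho {k : ℕ} {v : L2 d}
    (hv : v ∈ Submodule.span ℂ (moment V '' Set.Iic k))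
    (h : ∀ j ≤ k, inner ℂ (rho V j) v = 0) : v = 0 := by
  rw [← span_rho_Iic] at hv
  have : ∀ w ∈ Submodule.span ℂ (rho V '' Set.Iic k), inner ℂ w v = 0 := fun w hw => by
    induction hw using Submodule.span_induction with
    | mem x hx =>
      obtain ⟨j, hj, rfl⟩ := hx
      exact h j hj
    | zero => exact inner_zero_left _
    | add x y _ _ hx hy => rw [inner_add_left, hx, hy, add_zero]
    | smul c x _ hx => rw [inner_smul_left, hx, mul_zero]
  exact inner_self_eq_zero.1 (this v hv)

theorem rho_mem_span_of_le {j k : ℕ} (h : j ≤ k) :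
    rho V j ∈ Submodule.span ℂ (moment V '' Set.Iic k) :=
  Submodule.span_mono (Set.image_mono (Set.Iic_subset_Iic.2 h)) (rho_mem_span V j)

theorem hamRho_zero (hd : 0 < d) :
    hamRho V 0 = (polyA V 1 : ℂ) • rho V 1 + (polyB V 1 : ℂ) • rho V 0 := by
  have ho := rho_orthonormal V hd
  refine sub_eq_zero.1 (eq_zero_of_forall_inner_rho V (k := 1) ?_ fun j hj => ?_)
  · exact Submodule.sub_mem _ (hamRho_mem_span V 0) (Submodule.add_mem _
      (Submodule.smul_mem _ _ (rho_mem_span_of_le V le_rfl))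
      (Submodule.smul_mem _ _ (rho_mem_span_of_le V (by omega))))
  · simp only [inner_sub_right, inner_add_right, inner_smul_right, orthonormal_iff_ite.1 ho]
    interval_cases j
    · simp [inner_rho_hamRho_self_eq_polyB]
    · simp [inner_rho_succ_hamRho_eq_polyA]

/-- `H` raises the degree by one, and by symmetry it lowers it by at most one, so only three
coefficients survive. -/
theorem hamRho_succ (hd : 0 < d) (k : ℕ) :
    hamRho V (k + 1) = (polyA V (k + 2) : ℂ) • rho V (k + 2) + (polyB V (k + 2) : ℂ) • rho V (k + 1)
      + (polyA V (k + 1) : ℂ) • rho V k := by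
  have ho := rho_orthonormal V hd
  refine sub_eq_zero.1 (eq_zero_of_forall_inner_rho V (k := k + 2) ?_ fun j hj => ?_)
  · exact Submodule.sub_mem _ (hamRho_mem_span V (k + 1)) (Submodule.add_mem _ (Submodule.add_mem _
      (Submodule.smul_mem _ _ (rho_mem_span_of_le V le_rfl))
      (Submodule.smul_mem _ _ (rho_mem_span_of_le V (by omega))))
      (Submodule.smul_mem _ _ (rho_mem_span_of_le V (by omega))))
  · simp only [inner_sub_right, inner_add_right, inner_smul_right, orthonormal_iff_ite.1 ho]
    rcases lt_or_ge j k with h | h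
    · rw [← inner_hamRho_left, ← inner_conj_symm, inner_rho_hamRho_eq_zero V (by omega)]
      simp [show j ≠ k + 2 by omega, show j ≠ k + 1 by omega, show j ≠ k by omega]
    · obtain rfl | rfl | rfl : j = k ∨ j = k + 1 ∨ j = k + 2 := by omega
      · simp [inner_rho_hamRho_succ_eq_polyA]
      · simp [inner_rho_hamRho_self_eq_polyB]
      · simp [inner_rho_succ_hamRho_eq_polyA]

theorem rho_zero : rho V 0 = (delta V 0 : L2 d) := by
  have h1 : moment V 0 = (delta V 0 : L2 d) := by
    refine lp.ext (funext fun n => ?_)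
    change (Pi.single 0 1 : (Fin d → ℤ) → ℂ) n = lp.single (E := fun _ : Fin d → ℤ => ℂ) 2 0 1 n
    rw [lp.coeFn_single]
  have h2 : gs V 0 = moment V 0 := by
    have := moment_sub_gs_mem_span V 0
    simp only [Set.Iio_zero_eq_empty, Set.image_empty, Submodule.span_empty,
      Submodule.mem_bot] at this
    exact (sub_eq_zero.1 this).symm
  have h3 : ‖(delta V 0 : L2 d)‖ = 1 := by
    change ‖lp.single (E := fun _ : Fin d → ℤ => ℂ) 2 0 1‖ = 1
    rw [lp.norm_single (by norm_num), norm_one]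
  rw [rho_eq, h2, h1, h3]
  simp

/-- The coefficients of a vector `g` in the vectors `ρ_0, ρ_1, …`, with the value `-1` in front. -/
def rhoCoeff (g : L2 d) : ℕ → ℂ
  | 0 => -1
  | n + 1 => inner ℂ (rho V n) g

/-- Pair the resolvent equation with `ρ_n`. The source term appears only for `n = 0`; it is absorbed
as `a(0)G(0) = -1`, which makes the recurrence homogeneous. -/
theorem rhoCoeff_recurrence (hd : 0 < d) {z : ℂ} {g : (hamiltonian V).domain}
    (hg : hamiltonian V g - z • (g : L2 d) = delta V 0) (n : ℕ) :
    polyA V (n + 1) * rhoCoeff V g (n + 2) + polyA V n * rhoCoeff V g n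
      + polyB V (n + 1) * rhoCoeff V g (n + 1) = z * rhoCoeff V g (n + 1) := by
  have ho := rho_orthonormal V hd
  have h1 : inner ℂ (hamRho V n) (g : L2 d) = inner ℂ (rho V n) (hamiltonian V g) :=
    hamiltonian_symmetric V ⟨rho V n, rho_mem_domain V n⟩ g
  have h2 : hamiltonian V g = rho V 0 + z • (g : L2 d) := by
    rw [rho_zero, ← hg]
    abel
  rw [h2, inner_add_right, inner_smul_right, orthonormal_iff_ite.1 ho] at h1
  rcases n with _ | n
  · rw [hamRho_zero V hd] at h1
    simp only [inner_add_left, inner_smul_left, Complex.conj_ofReal] at h1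
    simp only [rhoCoeff, polyA] at h1 ⊢
    simp only [if_true] at h1
    push_cast
    linear_combination h1
  · rw [hamRho_succ V hd] at h1
    simp only [inner_add_left, inner_smul_left, Complex.conj_ofReal] at h1
    simp only [rhoCoeff]
    simp only [Nat.add_one_ne_zero, if_false] at h1
    linear_combination h1

/-- Bessel's inequality for the coefficients of `g`, localized to a ball. -/
theorem sum_rhoCoeff_le (hd : 0 < d) (g : L2 d) {ℓ R : ℝ} (h : (⌊ℓ⌋₊ : ℝ) < R) :
    ∑ n ∈ Finset.Icc 1 (⌊ℓ⌋₊ + 1), truncWeight ℓ n * ‖rhoCoeff V g n‖ ^ 2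
      ≤ ∑ n ∈ ball d R, ‖g n‖ ^ 2 := by
  classical
  let f : (Fin d → ℤ) → ℂ := fun n => if n ∈ ball d R then g n else 0
  have hfs : f.support.Finite := (ball d R).finite_toSet.subset fun n hn => by
    by_contra h
    exact hn (if_neg h)
  let χ : L2 d := ⟨f, memlp_of_finite hfs⟩
  have hχ : ‖χ‖ ^ 2 = ∑ n ∈ ball d R, ‖g n‖ ^ 2 := by
    refine (hasSum_norm_sq χ).unique ?_
    have h1 : ∑ n ∈ ball d R, ‖g n‖ ^ 2 = ∑ n ∈ ball d R, ‖χ n‖ ^ 2 :=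
      Finset.sum_congr rfl fun n hn => by
        change _ = ‖f n‖ ^ 2
        rw [show f n = g n from if_pos hn]
    rw [h1]
    refine hasSum_sum_of_ne_finset_zero fun n hn => ?_
    change ‖f n‖ ^ 2 = 0
    rw [show f n = 0 from if_neg hn, norm_zero]
    norm_num
  -- For these `k`, `ρ_k` is supported in `|n| ≤ k < R`, so cutting `g` off outside the ball changes
  -- no coefficient.
  have hinner : ∀ k ≤ ⌊ℓ⌋₊, inner ℂ (rho V k) g = inner ℂ (rho V k) χ := fun k hk => by
    rw [lp.inner_eq_tsum, lp.inner_eq_tsum]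
    refine tsum_congr fun n => ?_
    by_cases hn : n ∈ ball d R
    · rw [show χ n = g n from if_pos hn]
    · rw [rho_apply_eq_zero V k ?_, inner_zero_left, inner_zero_left]
      rw [mem_ball, not_lt] at hn
      have h1 : ((k : ℤ) : ℝ) < (siteNorm n : ℝ) := by
        push_cast
        exact lt_of_le_of_lt (Nat.cast_le.2 hk) (lt_of_lt_of_le h hn)
      exact_mod_cast h1
  calc ∑ n ∈ Finset.Icc 1 (⌊ℓ⌋₊ + 1), truncWeight ℓ n * ‖rhoCoeff V g n‖ ^ 2
      ≤ ∑ n ∈ Finset.Icc 1 (⌊ℓ⌋₊ + 1), ‖rhoCoeff V g n‖ ^ 2 :=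
        Finset.sum_le_sum fun n _ => mul_le_of_le_one_left (sq_nonneg _) (truncWeight_le_one ℓ n)
    _ = ∑ k ∈ Finset.range (⌊ℓ⌋₊ + 1), ‖inner ℂ (rho V k) χ‖ ^ 2 := by
        rw [Finset.range_eq_Ico, ← Finset.Ico_add_one_right_eq_Icc, ← Finset.sum_Ico_add' _ 0 _ 1]
        refine Finset.sum_congr rfl fun k hk => ?_
        rw [← hinner k (by have := (Finset.mem_Ico.1 hk).2; omega)]
        rfl
    _ ≤ ‖χ‖ ^ 2 := (rho_orthonormal V hd).sum_inner_products_le χ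
    _ = _ := hχ

/-- For `R > 1` the ball contains `0` and its neighbors; if `g` vanished there, `(H - z)g` would
vanish at `0`, where it equals `1`. -/
theorem exists_mem_ball_ne_zero {z : ℂ} {g : (hamiltonian V).domain}
    (hg : hamiltonian V g - z • (g : L2 d) = delta V 0) {R : ℝ} (hR : 1 < R) :
    ∃ n ∈ ball d R, (g : L2 d) n ≠ 0 := by
  by_contra! h
  have h0 : (0 : Fin d → ℤ) ∈ ball d R := by
    rw [mem_ball]
    simp [siteNorm]
    linarith
  have h1 : action V (g : L2 d) 0 - z * (g : L2 d) 0 = (delta V 0 : L2 d) 0 :=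
    congrArg (fun φ : L2 d => φ 0) hg
  have h2 : (delta V 0 : L2 d) 0 = 1 := lp.single_apply_self (E := fun _ : Fin d → ℤ => ℂ) 2 0 1
  have h3 : action V (g : L2 d) 0 = 0 := by
    change ∑ m ∈ neighbors 0, (g : L2 d) m + (V 0 : ℂ) * (g : L2 d) 0 = 0
    rw [h 0 h0, mul_zero, add_zero]
    refine Finset.sum_eq_zero fun m hm => h m ?_
    have : siteNorm m = 1 := by
      have := mem_neighbors.1 (mem_neighbors_comm.1 hm)
      simpa using this
    rw [mem_ball, this]
    simpa using hR
  rw [h2, h3, h 0 h0] at h1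
  simp at h1

end OrthonormalPolynomials

section TimeEvolution

open scoped FourierTransform ENNReal

/-! ### The time evolution and the resolvent -/

/-! ### The Laplace transform of the Fourier transform of a measure. -/

section Laplace

variable (μ : Measure ℝ) [IsFiniteMeasure μ]

theorem norm_exp_neg_I_mul (x t : ℝ) : ‖Complex.exp (-Complex.I * x * t)‖ = 1 := by
  rw [Complex.norm_exp]
  simp

theorem continuous_integral_exp :
    Continuous fun t : ℝ => ∫ x, Complex.exp (-Complex.I * x * t) ∂μ := by
  refine continuous_of_dominated (bound := fun _ => 1) (fun t => ?_) (fun t => ?_)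
    (integrable_const _) ?_
  · exact (by fun_prop : Continuous fun x : ℝ =>
      Complex.exp (-Complex.I * x * t)).aestronglyMeasurable
  · exact Filter.Eventually.of_forall fun x => (norm_exp_neg_I_mul x t).le
  · exact Filter.Eventually.of_forall fun x => by fun_prop

theorem norm_integral_exp_le (t : ℝ) :
    ‖∫ x, Complex.exp (-Complex.I * x * t) ∂μ‖ ≤ μ.real Set.univ := by
  refine (norm_integral_le_of_norm_le_const (C := 1)
    (Filter.Eventually.of_forall fun x => (norm_exp_neg_I_mul x t).le)).trans ?_
  rw [one_mul]

theorem integrableOn_exp_neg {c : ℝ} (hc : 0 < c) :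
    IntegrableOn (fun t : ℝ => Real.exp (-(c * t))) (Set.Ioi 0) := by
  have := integrableOn_exp_mul_Ioi (a := -c) (by linarith) 0
  simpa using this

theorem integrable_exp_prod {z : ℂ} (hz : 0 < z.im) :
    Integrable (fun p : ℝ × ℝ => Complex.exp (Complex.I * z * p.1)
      * Complex.exp (-Complex.I * p.2 * p.1)) ((volume.restrict (Set.Ioi 0)).prod μ) := by
  have h1 : Integrable (fun p : ℝ × ℝ => Real.exp (-(z.im * p.1)) * 1)
      ((volume.restrict (Set.Ioi 0)).prod μ) :=
    (integrableOn_exp_neg hz).mul_prod (integrable_const (μ := μ) (1 : ℝ))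
  refine h1.mono (Continuous.aestronglyMeasurable (by fun_prop))
    (Filter.Eventually.of_forall fun p => le_of_eq ?_)
  rw [norm_mul, norm_exp_neg_I_mul, Complex.norm_exp, mul_one, mul_one, Real.norm_eq_abs,
    Real.abs_exp]
  simp

theorem integrable_exp_mul_integral {z : ℂ} (hz : 0 < z.im) :
    Integrable (fun t : ℝ => Complex.exp (Complex.I * z * t)
      * ∫ x, Complex.exp (-Complex.I * x * t) ∂μ) (volume.restrict (Set.Ioi 0)) := by
  have := (integrable_exp_prod μ hz).integral_prod_left
  simpa only [integral_const_mul] using this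

/-- The Laplace transform of the Fourier transform of `μ` is its Borel transform. -/
theorem laplace_integral_exp {z : ℂ} (hz : 0 < z.im) :
    ∫ t in Set.Ioi (0 : ℝ), Complex.exp (Complex.I * z * t)
      * ∫ x, Complex.exp (-Complex.I * x * t) ∂μ = -Complex.I * ∫ x, ((x : ℂ) - z)⁻¹ ∂μ := by
  have h := integral_integral_swap (f := fun (t x : ℝ) => Complex.exp (Complex.I * z * t)
      * Complex.exp (-Complex.I * x * t)) (integrable_exp_prod μ hz)
  simp only [integral_const_mul] at h
  rw [h, ← integral_const_mul]
  congr 1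
  funext x
  have hre : (Complex.I * (z - x)).re < 0 := by simpa using hz
  have hne : (x : ℂ) - z ≠ 0 := fun h0 => by
    have := congrArg Complex.im h0
    simp at this
    exact hz.ne' this
  have h2 := integral_exp_mul_complex_Ioi hre 0
  have h3 : ∀ t : ℝ, Complex.exp (Complex.I * z * t) * Complex.exp (-Complex.I * x * t)
      = Complex.exp (Complex.I * (z - x) * t) := fun t => by
    rw [← Complex.exp_add]
    ring_nf
  simp only [h3]
  rw [h2]
  have hne' : z - (x : ℂ) ≠ 0 := fun h0 => hne (by linear_combination -h0)
  simp only [Complex.ofReal_zero, mul_zero, Complex.exp_zero]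
  field_simp
  rw [Complex.I_sq]
  ring

end Laplace

variable {d : ℕ} (V : (Fin d → ℤ) → ℝ)

instance isFiniteMeasure_spectralMeasure (ψ : (hamiltonian V).domain) :
    IsFiniteMeasure (spectralMeasure V ψ) := (spectralMeasure_spec V ψ).1

theorem inner_delta (n : Fin d → ℤ) (g : L2 d) : inner ℂ (delta V n : L2 d) g = g n := by
  change inner ℂ (lp.single (E := fun _ : Fin d → ℤ => ℂ) 2 n 1) g = g n
  rw [lp.inner_single_left]
  simp

/-- The polarization identity for the resolvent. -/
theorem sum_polarization {z : ℂ} (hz : z.im ≠ 0) (φ ψ : (hamiltonian V).domain)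
    {g : (hamiltonian V).domain} (hg : hamiltonian V g - z • (g : L2 d) = ψ) :
    (1 / 4) * ∑ k ∈ Finset.range 4,
      (-Complex.I) ^ k * ∫ x, ((x : ℂ) - z)⁻¹ ∂spectralMeasure V (φ + Complex.I ^ k • ψ)
      = inner ℂ (φ : L2 d) (g : L2 d) := by
  -- The spectral measure determines only diagonal elements, so polarization needs the resolvent of
  -- `φ + i^k ψ`, which is `p + i^k g`.
  obtain ⟨p, hp⟩ := exists_resolvent V hz (φ : L2 d)
  have h : ∀ k : ℕ, ∫ x, ((x : ℂ) - z)⁻¹ ∂spectralMeasure V (φ + Complex.I ^ k • ψ)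
      = inner ℂ ((φ : L2 d) + Complex.I ^ k • (ψ : L2 d)) ((p : L2 d) + Complex.I ^ k • (g : L2 d)) := by
    intro k
    refine ((spectralMeasure_spec V (φ + Complex.I ^ k • ψ)).2 z hz (p + Complex.I ^ k • g) ?_).symm
    rw [LinearPMap.map_add, LinearPMap.map_smul]
    change _ - z • ((p : L2 d) + Complex.I ^ k • (g : L2 d))
      = (φ : L2 d) + Complex.I ^ k • (ψ : L2 d)
    rw [← hp, ← hg]
    module
  simp only [h, inner_add_left, inner_add_right, inner_smul_left, inner_smul_right]
  simp only [Finset.sum_range_succ, Finset.sum_range_zero, pow_succ, pow_zero, map_mul, map_one,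
    Complex.conj_I]
  ring_nf
  simp only [show Complex.I ^ 3 = -Complex.I by rw [pow_succ, Complex.I_sq]; ring,
    show Complex.I ^ 4 = 1 by exact Complex.I_pow_four,
    show Complex.I ^ 6 = -1 by rw [pow_add _ 4 2, Complex.I_pow_four, Complex.I_sq, one_mul],
    show Complex.I ^ 9 = Complex.I by
      rw [pow_add _ 4 5, Complex.I_pow_four, pow_succ, Complex.I_pow_four]; ring, Complex.I_sq]
  ring

theorem wavepacket_eq (t : ℝ) (n : Fin d → ℤ) : wavepacket V t n
    = (1 / 4) * ∑ k ∈ Finset.range 4, (-Complex.I) ^ k *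
      ∫ x, Complex.exp (-Complex.I * x * t)
        ∂spectralMeasure V (delta V n + Complex.I ^ k • delta V 0) := rfl

theorem continuous_wavepacket (n : Fin d → ℤ) : Continuous fun t => wavepacket V t n := by
  simp only [wavepacket_eq]
  exact continuous_const.mul (continuous_finsetSum _ fun k _ =>
    continuous_const.mul (continuous_integral_exp _))

theorem exists_norm_wavepacket_le (n : Fin d → ℤ) : ∃ M : ℝ, ∀ t, ‖wavepacket V t n‖ ≤ M := by
  refine ⟨‖(1 / 4 : ℂ)‖ * ∑ k ∈ Finset.range 4, ‖(-Complex.I) ^ k‖ *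
    (spectralMeasure V (delta V n + Complex.I ^ k • delta V 0)).real Set.univ, fun t => ?_⟩
  rw [wavepacket_eq, norm_mul]
  gcongr
  refine (norm_sum_le _ _).trans (Finset.sum_le_sum fun k _ => ?_)
  rw [norm_mul]
  gcongr
  exact norm_integral_exp_le _ t

/-- The Laplace transform of the wavepacket is the resolvent. -/
theorem laplace_wavepacket {z : ℂ} (hz : 0 < z.im) (n : Fin d → ℤ) {g : (hamiltonian V).domain}
    (hg : hamiltonian V g - z • (g : L2 d) = delta V 0) :
    ∫ t in Set.Ioi (0 : ℝ), Complex.exp (Complex.I * z * t) * wavepacket V t n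
      = -Complex.I * (g : L2 d) n := by
  have h1 : ∀ t : ℝ, Complex.exp (Complex.I * z * t) * wavepacket V t n
      = (1 / 4) * ∑ k ∈ Finset.range 4, (-Complex.I) ^ k * (Complex.exp (Complex.I * z * t) *
      ∫ x, Complex.exp (-Complex.I * x * t)
        ∂spectralMeasure V (delta V n + Complex.I ^ k • delta V 0)) := fun t => by
    rw [wavepacket_eq, mul_left_comm, Finset.mul_sum]
    congr 1
    exact Finset.sum_congr rfl fun k _ => mul_left_comm _ _ _
  simp only [h1]
  rw [integral_const_mul, integral_finsetSum _ fun k _ =>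
    (integrable_exp_mul_integral _ hz).const_mul _]
  simp only [integral_const_mul, laplace_integral_exp _ hz]
  rw [← inner_delta V n, ← sum_polarization V hz.ne' (delta V n) (delta V 0) hg]
  simp only [Finset.mul_sum]
  exact Finset.sum_congr rfl fun k _ => by ring

/-- The damped wavepacket `e^{-εt}⟨δ_n, e^{-iHt}δ_0⟩`, `t > 0`. -/
def damped (ε : ℝ) (n : Fin d → ℤ) : ℝ → ℂ :=
  (Set.Ioi 0).indicator fun t => (Real.exp (-(ε * t)) : ℂ) * wavepacket V t n

theorem exists_norm_damped_le (ε : ℝ) (n : Fin d → ℤ) : ∃ M : ℝ, ∀ t,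
    ‖damped V ε n t‖ ≤ (Set.Ioi 0).indicator (fun t => Real.exp (-(ε * t)) * M) t := by
  obtain ⟨M, hM⟩ := exists_norm_wavepacket_le V n
  refine ⟨M, fun t => ?_⟩
  by_cases ht : t ∈ Set.Ioi (0 : ℝ)
  · rw [damped, Set.indicator_of_mem ht, Set.indicator_of_mem ht, norm_mul, Complex.norm_real,
      Real.norm_eq_abs, Real.abs_exp]
    gcongr
    exact hM t
  · rw [damped, Set.indicator_of_notMem ht, Set.indicator_of_notMem ht, norm_zero]

theorem aestronglyMeasurable_damped (ε : ℝ) (n : Fin d → ℤ) :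
    AEStronglyMeasurable (damped V ε n) volume := by
  have := continuous_wavepacket V n
  exact (Continuous.aestronglyMeasurable (by fun_prop)).indicator measurableSet_Ioi

theorem integrable_damped {ε : ℝ} (hε : 0 < ε) (n : Fin d → ℤ) : Integrable (damped V ε n) := by
  obtain ⟨M, hM⟩ := exists_norm_damped_le V ε n
  exact ((integrable_indicator_iff measurableSet_Ioi).2 ((integrableOn_exp_neg hε).mul_const M)).mono'
    (aestronglyMeasurable_damped V ε n) (Filter.Eventually.of_forall hM)

theorem memLp_damped {ε : ℝ} (hε : 0 < ε) (n : Fin d → ℤ) : MemLp (damped V ε n) 2 := by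
  rw [memLp_two_iff_integrable_sq_norm (aestronglyMeasurable_damped V ε n)]
  obtain ⟨M, hM⟩ := exists_norm_damped_le V ε n
  refine ((integrable_indicator_iff measurableSet_Ioi).2
    ((integrableOn_exp_neg (c := 2 * ε) (by positivity)).mul_const (M ^ 2))).mono'
    ((aestronglyMeasurable_damped V ε n).norm.pow 2) (Filter.Eventually.of_forall fun t => ?_)
  rw [Real.norm_of_nonneg (sq_nonneg _)]
  refine (pow_le_pow_left₀ (norm_nonneg _) (hM t) 2).trans (le_of_eq ?_)
  by_cases ht : t ∈ Set.Ioi (0 : ℝ)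
  · rw [Set.indicator_of_mem ht, Set.indicator_of_mem ht, mul_pow, ← Real.exp_nat_mul]
    push_cast
    ring_nf
  · rw [Set.indicator_of_notMem ht, Set.indicator_of_notMem ht]
    norm_num

/-- The complex energy belonging to the frequency `ξ` of the Fourier transform. -/
def energy (ε ξ : ℝ) : ℂ := ⟨-2 * Real.pi * ξ, ε⟩

/-- With `z = -2πξ + iε`, the Fourier phase times the damping is `e^{izt}`, so this is the Laplace
transform at `z`. -/
theorem fourier_damped {ε : ℝ} (hε : 0 < ε) (n : Fin d → ℤ) (ξ : ℝ) {g : (hamiltonian V).domain}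
    (hg : hamiltonian V g - energy ε ξ • (g : L2 d) = delta V 0) :
    𝓕 (damped V ε n) ξ = -Complex.I * (g : L2 d) n := by
  rw [← laplace_wavepacket V (z := energy ε ξ) hε n hg, Real.fourier_real_eq_integral_exp_smul,
    ← integral_indicator measurableSet_Ioi]
  congr 1
  funext t
  by_cases ht : t ∈ Set.Ioi (0 : ℝ)
  · rw [damped, Set.indicator_of_mem ht, Set.indicator_of_mem ht, smul_eq_mul, ← mul_assoc,
      Complex.ofReal_exp, ← Complex.exp_add]
    congr 2
    have : energy ε ξ = ((-2 * Real.pi * ξ : ℝ) : ℂ) + ε * Complex.I := Complex.mk_eq_add_mul_I _ _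
    rw [this]
    push_cast
    linear_combination (-(ε : ℂ) * t) * Complex.I_sq
  · rw [damped, Set.indicator_of_notMem ht, Set.indicator_of_notMem ht, smul_zero]

/-- The time-averaged weight in a ball, in terms of the damped wavepacket. -/
theorem timeAverage_ballWeight {T : ℝ} (hT : 0 < T) (R : ℝ) :
    timeAverage T (fun t => ballWeight R (wavepacket V t))
      = 2 / T * ∑ n ∈ ball d R, ∫ t, ‖damped V T⁻¹ n t‖ ^ 2 := by
  have hε : 0 < T⁻¹ := inv_pos.2 hT
  rw [timeAverage, ← integral_finsetSum _ fun n _ =>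
    (memLp_two_iff_integrable_sq_norm (aestronglyMeasurable_damped V T⁻¹ n)).1 (memLp_damped V hε n),
    ← integral_indicator measurableSet_Ioi]
  congr 2
  funext t
  by_cases ht : t ∈ Set.Ioi (0 : ℝ)
  · rw [Set.indicator_of_mem ht, ballWeight, Finset.mul_sum]
    refine Finset.sum_congr rfl fun n _ => ?_
    rw [damped, Set.indicator_of_mem ht, norm_mul, mul_pow, Complex.norm_real, Real.norm_eq_abs,
      Real.abs_exp, ← Real.exp_nat_mul]
    congr 2
    push_cast
    ring
  · rw [Set.indicator_of_notMem ht]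
    refine (Finset.sum_eq_zero fun n _ => ?_).symm
    rw [damped, Set.indicator_of_notMem ht]
    simp

theorem ofReal_timeAverage_ballWeight {T : ℝ} (hT : 0 < T) (R : ℝ) :
    ENNReal.ofReal (timeAverage T (fun t => ballWeight R (wavepacket V t)))
      = ENNReal.ofReal (2 / T) * ∑ n ∈ ball d R, ∫⁻ ξ, ‖𝓕 (damped V T⁻¹ n) ξ‖ₑ ^ 2 := by
  have hε : 0 < T⁻¹ := inv_pos.2 hT
  rw [timeAverage_ballWeight V hT, ENNReal.ofReal_mul (by positivity),
    ENNReal.ofReal_sum_of_nonneg fun n _ => integral_nonneg fun t => by positivity]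
  congr 1
  refine Finset.sum_congr rfl fun n _ => ?_
  rw [lintegral_fourier_sq (integrable_damped V hε n) (memLp_damped V hε n),
    ofReal_integral_eq_lintegral_ofReal
      ((memLp_two_iff_integrable_sq_norm (aestronglyMeasurable_damped V T⁻¹ n)).1
        (memLp_damped V hε n)) (Filter.Eventually.of_forall fun t => by positivity)]
  refine lintegral_congr fun t => ?_
  rw [ENNReal.ofReal_pow (norm_nonneg _), ofReal_norm]

end TimeEvolution

/-! ### The dynamical lower bound. -/

section DynamicalBound

open scoped FourierTransform ENNReal

variable {d : ℕ} (V : (Fin d → ℤ) → ℝ)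

/-- This supplies the strict inequality, including when the spectral measure of the set is zero. A
zero average would make all the Fourier transforms in the ball vanish at a common frequency, against
`exists_mem_ball_ne_zero`. -/
theorem timeAverage_ballWeight_pos {T R : ℝ} (hT : 0 < T) (hR : 1 < R) :
    0 < timeAverage T (fun t => ballWeight R (wavepacket V t)) := by
  have hε : 0 < T⁻¹ := inv_pos.2 hT
  rw [← ENNReal.ofReal_pos, ofReal_timeAverage_ballWeight V hT]
  refine ENNReal.mul_pos (ENNReal.ofReal_pos.2 (by positivity)).ne' fun h => ?_
  have h1 : ∀ n ∈ ball d R, ∀ᵐ ξ, 𝓕 (damped V T⁻¹ n) ξ = 0 := fun n hn => by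
    have h2 := (Finset.sum_eq_zero_iff.1 h) n hn
    have hc : Continuous (𝓕 (damped V T⁻¹ n)) :=
      VectorFourier.fourierIntegral_continuous Real.continuous_fourierChar (by fun_prop)
        (integrable_damped V hε n)
    rw [lintegral_eq_zero_iff (by fun_prop)] at h2
    filter_upwards [h2] with ξ hξ
    simpa using hξ
  obtain ⟨ξ, hξ⟩ := ((Finset.eventually_all (ball d R)).2 h1).exists
  obtain ⟨g, hg⟩ := exists_resolvent V (z := energy T⁻¹ ξ) hε.ne' (delta V 0 : L2 d)
  obtain ⟨n, hn, hne⟩ := exists_mem_ball_ne_zero V hg hR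
  have := hξ n hn
  rw [fourier_damped V hε n ξ hg] at this
  simp [hne] at this

/-- The imaginary part of the Borel transform, as a Poisson integral. -/
theorem im_integral_inv (μ : Measure ℝ) [IsFiniteMeasure μ] {ε : ℝ} (hε : 0 < ε) (ξ : ℝ) :
    ENNReal.ofReal (∫ x, ((x : ℂ) - energy ε ξ)⁻¹ ∂μ).im
      = ∫⁻ x, ENNReal.ofReal (ε / ((x + 2 * Real.pi * ξ) ^ 2 + ε ^ 2)) ∂μ := by
  have hne : ∀ x : ℝ, (x : ℂ) - energy ε ξ ≠ 0 := fun x h => by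
    have := congrArg Complex.im h
    simp [energy] at this
    exact hε.ne' this
  have him : ∀ x : ℝ, (((x : ℂ) - energy ε ξ)⁻¹).im
      = ε / ((x + 2 * Real.pi * ξ) ^ 2 + ε ^ 2) := fun x => by
    rw [Complex.inv_im, Complex.normSq_apply]
    simp only [energy, Complex.sub_re, Complex.sub_im, Complex.ofReal_re, Complex.ofReal_im]
    congr 1 <;> ring
  have hint : Integrable (fun x : ℝ => ((x : ℂ) - energy ε ξ)⁻¹) μ := by
    refine Integrable.mono' (integrable_const ε⁻¹)
      (Continuous.aestronglyMeasurable (by fun_prop (disch := exact hne _)))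
      (Filter.Eventually.of_forall fun x => ?_)
    rw [norm_inv]
    gcongr
    have := Complex.abs_im_le_norm ((x : ℂ) - energy ε ξ)
    simpa [energy, abs_of_pos hε] using this
  have h1 : (∫ x, ((x : ℂ) - energy ε ξ)⁻¹ ∂μ).im = ∫ x, (((x : ℂ) - energy ε ξ)⁻¹).im ∂μ :=
    (integral_im hint).symm
  have h2 : Integrable (fun x : ℝ => (((x : ℂ) - energy ε ξ)⁻¹).im) μ := hint.im
  rw [h1, ofReal_integral_eq_lintegral_ofReal h2 (Filter.Eventually.of_forall fun x => by
    simp only [him, Pi.zero_apply]; positivity)]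
  simp only [him]

/-- The resolvent in a ball dominates the Borel transform of the spectral measure, near an energy of
small length scale. -/
theorem im_le_sum_fourier (hd : 0 < d) {ε L E ξ : ℝ} (hε : 0 < ε) (hL : 0 ≤ L)
    (hE : lengthScale (polyA V) (polyB V) ε E ≤ ENNReal.ofReal L)
    (hξ : |-2 * Real.pi * ξ - E| < ε) :
    ENNReal.ofReal (∫ x, ((x : ℂ) - energy ε ξ)⁻¹ ∂spectralMeasure V (delta V 0)).im
      ≤ ENNReal.ofReal (5 * ε) * ∑ n ∈ ball d (L + 1), ‖𝓕 (damped V ε n) ξ‖ₑ ^ 2 := by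
  obtain ⟨g, hg⟩ := exists_resolvent V (z := energy ε ξ) hε.ne' (delta V 0 : L2 d)
  -- The strict bound by `⌊L⌋ + 1` yields an actual `ℓ` without attaining the infimum, and still
  -- forces `⌊ℓ⌋ ≤ ⌊L⌋`.
  have h1 : lengthScale (polyA V) (polyB V) ε E < ENNReal.ofReal (⌊L⌋₊ + 1) :=
    lt_of_le_of_lt hE ((ENNReal.ofReal_lt_ofReal_iff (by positivity)).2 (Nat.lt_floor_add_one L))
  obtain ⟨_, ⟨ℓ, hℓ, rfl, hscale⟩, hℓL⟩ := sInf_lt_iff.1 h1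
  have hfloor : (⌊ℓ⌋₊ : ℝ) < L + 1 := by
    have h2 : ℓ < (⌊L⌋₊ + 1 : ℕ) := by
      push_cast
      exact (ENNReal.ofReal_lt_ofReal_iff (by positivity)).1 hℓL
    have h3 : ⌊ℓ⌋₊ ≤ ⌊L⌋₊ := Nat.lt_succ_iff.1 ((Nat.floor_lt hℓ).2 h2)
    have h4 : (⌊ℓ⌋₊ : ℝ) ≤ ⌊L⌋₊ := by exact_mod_cast h3
    linarith [Nat.floor_le hL]
  -- The real part is off by less than `ε` and the imaginary part is exactly `ε`.
  have hz : ‖energy ε ξ - E‖ ^ 2 ≤ 2 * ε ^ 2 := by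
    rw [Complex.sq_norm, Complex.normSq_apply]
    simp only [energy, Complex.sub_re, Complex.sub_im, Complex.ofReal_re, Complex.ofReal_im]
    have := sq_le_sq' (by linarith [(abs_lt.1 hξ).1]) (abs_lt.1 hξ).2.le
    nlinarith
  have hG := im_le_of_lengthScale (polyA_ne_zero V hd) rfl (rhoCoeff_recurrence V hd hg) rfl hε hℓ
    hz hscale
  have hG1 : rhoCoeff V g 1 = ∫ x, ((x : ℂ) - energy ε ξ)⁻¹ ∂spectralMeasure V (delta V 0) := by
    rw [← (spectralMeasure_spec V (delta V 0)).2 (energy ε ξ) hε.ne' g hg, ← rho_zero]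
    rfl
  rw [← hG1]
  have h5 : ∀ n, ‖𝓕 (damped V ε n) ξ‖ₑ ^ 2 = ENNReal.ofReal (‖(g : L2 d) n‖ ^ 2) := fun n => by
    rw [fourier_damped V hε n ξ hg, ENNReal.ofReal_pow (norm_nonneg _), ← ofReal_norm, norm_mul,
      norm_neg, Complex.norm_I, one_mul]
  simp only [h5]
  rw [← ENNReal.ofReal_sum_of_nonneg fun n _ => by positivity,
    ← ENNReal.ofReal_mul (by positivity)]
  refine ENNReal.ofReal_le_ofReal (hG.trans ?_)
  gcongr
  exact sum_rhoCoeff_le V hd g hfloor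

/-- The total Poisson integral of a measure `μ` over frequencies whose energies are `ε`-close to `S`
dominates `μ S`. -/
theorem measure_le_lintegral_poisson (μ : Measure ℝ) [IsFiniteMeasure μ] {ε : ℝ} (hε : 0 < ε)
    (S : Set ℝ) {N : Set ℝ} (hN : N = {ξ | ∃ E ∈ S, |-2 * Real.pi * ξ - E| < ε}) :
    ENNReal.ofReal (1 / (2 * Real.pi)) * μ S
      ≤ ∫⁻ ξ in N, ∫⁻ x, ENNReal.ofReal (ε / ((x + 2 * Real.pi * ξ) ^ 2 + ε ^ 2)) ∂μ := by
  have hm : Measurable fun p : ℝ × ℝ =>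
      ENNReal.ofReal (ε / ((p.2 + 2 * Real.pi * p.1) ^ 2 + ε ^ 2)) := by fun_prop
  have hm' : Measurable fun p : ℝ × ℝ =>
      ENNReal.ofReal (ε / ((p.1 + 2 * Real.pi * p.2) ^ 2 + ε ^ 2)) := by fun_prop
  rw [lintegral_lintegral_swap hm.aemeasurable]
  -- Markov's inequality: `S` lies in the set where the inner integral is at least `1/(2π)`, so `S`
  -- itself need not be measurable.
  refine le_trans ?_ 
    (mul_meas_ge_le_lintegral hm'.lintegral_prod_right (ENNReal.ofReal (1 / (2 * Real.pi))))
  gcongr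
  intro x hx
  -- These are the frequencies with energy within `ε` of `x`: length `ε/π`, with Poisson kernel at
  -- least `1/(2ε)`, which gives `1/(2π)`.
  let B : Set ℝ := Set.Ioo ((-x - ε) / (2 * Real.pi)) ((-x + ε) / (2 * Real.pi))
  have hpi : 0 < 2 * Real.pi := by positivity
  have hB : ∀ ξ ∈ B, |-2 * Real.pi * ξ - x| < ε := fun ξ hξ => by
    have h1 := (div_lt_iff₀ hpi).1 hξ.1
    have h2 := (lt_div_iff₀ hpi).1 hξ.2
    rw [abs_lt]
    constructor <;> linarith
  have hBN : B ⊆ N := fun ξ hξ => hN ▸ ⟨x, hx, hB ξ hξ⟩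
  calc ENNReal.ofReal (1 / (2 * Real.pi))
      = ∫⁻ _ in B, ENNReal.ofReal (1 / (2 * ε)) := by
        rw [setLIntegral_const, Real.volume_Ioo, ← ENNReal.ofReal_mul (by positivity)]
        congr 1
        field_simp
        ring
    _ ≤ ∫⁻ ξ in B, ENNReal.ofReal (ε / ((x + 2 * Real.pi * ξ) ^ 2 + ε ^ 2)) := by
        refine setLIntegral_mono (by fun_prop) fun ξ hξ => ENNReal.ofReal_le_ofReal ?_
        have h1 := abs_lt.1 (hB ξ hξ)
        rw [div_le_div_iff₀ (by positivity) (by positivity)]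
        nlinarith [mul_pos (sub_pos.2 h1.1) (sub_pos.2 h1.2)]
    _ ≤ _ := lintegral_mono_set hBN

/-- Integrate the pointwise resolvent bound over the frequencies near the set and apply Plancherel.
Against the prefactor `2/T`, the factor `5/T` becomes `5/2`, and the Poisson integral contributes
`2π`. -/
theorem measure_le_timeAverage (hd : 0 < d) {T L : ℝ} (hT : 0 < T) (hL : 0 ≤ L) :
    (spectralMeasure V (delta V 0)).real
        {E : ℝ | lengthScale (polyA V) (polyB V) T⁻¹ E ≤ ENNReal.ofReal L}
      ≤ 5 * Real.pi * timeAverage T (fun t => ballWeight (L + 1) (wavepacket V t)) := by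
  have hε : 0 < T⁻¹ := inv_pos.2 hT
  have hpi := Real.pi_pos
  set S := {E : ℝ | lengthScale (polyA V) (polyB V) T⁻¹ E ≤ ENNReal.ofReal L}
  set μ := spectralMeasure V (delta V 0)
  set N := {ξ | ∃ E ∈ S, |-2 * Real.pi * ξ - E| < T⁻¹} with hN
  set A := timeAverage T (fun t => ballWeight (L + 1) (wavepacket V t)) with hA
  -- `N` is a union of open intervals, hence measurable whatever `S` is.
  have hNm : MeasurableSet N := by
    refine IsOpen.measurableSet ?_
    have : N = ⋃ E ∈ S, {ξ | |-2 * Real.pi * ξ - E| < T⁻¹} := by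
      ext
      simp [hN]
    rw [this]
    exact isOpen_biUnion fun E _ => isOpen_lt (by fun_prop) continuous_const
  have h1 : ENNReal.ofReal (1 / (2 * Real.pi)) * μ S
      ≤ ENNReal.ofReal (5 * T⁻¹)
        * ∑ n ∈ ball d (L + 1), ∫⁻ ξ, ‖𝓕 (damped V T⁻¹ n) ξ‖ₑ ^ 2 := by
    have hc : ∀ n, Continuous (𝓕 (damped V T⁻¹ n)) := fun n =>
      VectorFourier.fourierIntegral_continuous Real.continuous_fourierChar (by fun_prop)
        (integrable_damped V hε n)
    calc _ ≤ _ := measure_le_lintegral_poisson μ hε S hN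
      _ ≤ ∫⁻ ξ in N, ENNReal.ofReal (5 * T⁻¹)
          * ∑ n ∈ ball d (L + 1), ‖𝓕 (damped V T⁻¹ n) ξ‖ₑ ^ 2 := by
          refine setLIntegral_mono' hNm fun ξ hξ => ?_
          obtain ⟨E, hE, hξE⟩ := hξ
          rw [← im_integral_inv μ hε]
          exact im_le_sum_fourier V hd hε hL hE hξE
      _ ≤ ∫⁻ ξ, ENNReal.ofReal (5 * T⁻¹)
          * ∑ n ∈ ball d (L + 1), ‖𝓕 (damped V T⁻¹ n) ξ‖ₑ ^ 2 := setLIntegral_le_lintegral _ _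
      _ = _ := by
          rw [lintegral_const_mul' _ _ ENNReal.ofReal_ne_top,
            lintegral_finsetSum _ fun n _ => by have := hc n; fun_prop]
  have hA0 : 0 ≤ 5 / 2 * A := by
    rw [hA, timeAverage_ballWeight V hT]
    have : 0 ≤ ∑ n ∈ ball d (L + 1), ∫ t, ‖damped V T⁻¹ n t‖ ^ 2 :=
      Finset.sum_nonneg fun n _ => integral_nonneg fun t => by positivity
    positivity
  have h2 : ENNReal.ofReal (5 * T⁻¹)
      * ∑ n ∈ ball d (L + 1), ∫⁻ ξ, ‖𝓕 (damped V T⁻¹ n) ξ‖ₑ ^ 2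
      = ENNReal.ofReal (5 / 2 * A) := by
    rw [ENNReal.ofReal_mul (p := 5 / 2) (by norm_num), hA, ofReal_timeAverage_ballWeight V hT, ← mul_assoc,
      ← ENNReal.ofReal_mul (by norm_num)]
    congr 2
    field_simp
  rw [h2, ← ofReal_measureReal, ← ENNReal.ofReal_mul (by positivity),
    ENNReal.ofReal_le_ofReal_iff hA0] at h1
  calc μ.real S = 2 * Real.pi * (1 / (2 * Real.pi) * μ.real S) := by field_simp
    _ ≤ 2 * Real.pi * (5 / 2 * A) := by gcongr
    _ = _ := by ring

end DynamicalBound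

end Lattice

end

theorem theorem7 :
    ∃ C : ℝ, 0 < C ∧ ∀ (d : ℕ) (_ : 0 < d) (V : (Fin d → ℤ) → ℝ) (T L : ℝ), 0 < T → 1 < L →
      C * (Lattice.spectralMeasure V (Lattice.delta V 0)).real
          {E : ℝ | Lattice.lengthScale (Lattice.polyA V) (Lattice.polyB V) T⁻¹ E
            ≤ ENNReal.ofReal L}
        < Lattice.timeAverage T (fun t => Lattice.ballWeight (L + 1) (Lattice.wavepacket V t)) := by
  -- Any constant below `1/(5π)` would do: `5π < 20 < 32`, and the time average is positive.
  refine ⟨1 / 32, by norm_num, fun d hd V T L hT hL => ?_⟩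
  have h1 := Lattice.measure_le_timeAverage V hd hT (zero_le_one.trans hL.le)
  have h2 := Lattice.timeAverage_ballWeight_pos V hT (by linarith : 1 < L + 1)
  nlinarith [Real.pi_lt_four]
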